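/- Let $\pi$ be a crystallographic group, i.e. a discrete subgroup of $\operatorname{Iso}(\mathbb R^n)=\mathrm O(n)\ltimes\mathbb R^n$ for which there is a compact set in $\mathbb R^n$ whose $\pi$-translates cover $\mathbb R^n$, and let $\mathcal O=\mathbb R^n/\pi$ be the corresponding closed flat orbifold. Let $\mathfrak r\colon\mathrm{Aff}(\mathbb R^n)=\mathsf{GL}(n)\ltimes\mathbb R^n\to\mathsf{GL}(n)$, $\mathfrak r(A,v)=A$, be the linear part, let $H_\pi=\mathfrak r(\pi)$ be the holonomy group, and set $$\mathcal C_\pi=\{A\in\mathsf{GL}(n): A\,H_\pi A^{-1}\subset\mathrm O(n)\},\qquad \mathcal N_\pi=\mathfrak r\big(\mathrm N_{\mathrm{Aff}(\mathbb R^n)}(\pi)\big).$$ The Teichmüller space of $\mathcal O$ is the orbit space $\mathcal T_{\rm flat}(\mathcal O)=\mathrm O(n)\backslash\mathcal C_\pi$ of the action of $\mathrm O(n)$ on $\mathcal C_\pi$ by left multiplication; the group $\mathcal N_\pi$ acts on it from the right by multiplication. A flat metric on $\mathcal O$ is a smooth $\pi$-invariant Riemannian metric on $\mathbb R^n$ that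 is locally isometric to the Euclidean metric; for a group $\pi'\subset\operatorname{Iso}(\mathbb R^n)$, $\mathrm g_{\pi'}$ denotes the metric on $\mathbb R^n/\pi'$ induced by the Euclidean metric of $\mathbb R^n$. Two such metrics, on $\mathbb R^n/\pi$ and on $\mathbb R^n/\pi'$, are isometric if there is a homeomorphism $f\colon\mathbb R^n/\pi\to\mathbb R^n/\pi'$ such that, whenever $f([x])=[y]$, there is a diffeomorphism between open neighbourhoods of $x$ and $y$ in $\mathbb R^n$ which lifts $f$, maps $x$ to $y$, and pulls the second metric back to the first. The moduli space $\mathcal M_{\rm flat}(\mathcal O)$ is the set of isometry classes of flat metrics on $\mathcal O$. Then $\mathcal N_\pi$ is a discrete subgroup of $\mathsf{GL}(n)$, and $$\mathcal M_{\rm flat}(\mathcal O)=\mathcal T_{\rm flat}(\mathcal O)/\mathcal N_\pi .$$ More precisely, there is a bijection $\Phi\colon\mathcal T_{\rm flat}(\mathcal O)/\mathcal N_\pi\to\mathcal M_{\rm flat}(\mathcal O)$ such that, for every $(A,v)\in\mathrm{Aff}(\mathbb R^n)$ with $A\in\mathcal C_\pi$, $\Phi$ maps the class of $A$ to the isometry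 class consisting of all flat metrics $\mathrm g$ on $\mathcal O$ for which $(\mathcal O,\mathrm g)$ is isometric to $(\mathbb R^n/\pi',\mathrm g_{\pi'})$, where $\pi'=(A,v)\,\pi\,(A,v)^{-1}$. -/

import Mathlib

open scoped ContDiff

noncomputable section

namespace FlatOrbifold

/-- Euclidean space `ℝⁿ`. -/
abbrev E (n : ℕ) : Type := EuclideanSpace ℝ (Fin n)

/-- The group `Aff(ℝⁿ)` of affine transformations of `ℝⁿ`. -/
abbrev Aff (n : ℕ) : Type := E n ≃ᵃ[ℝ] E n

/-- The group `GL(n)` of linear automorphisms of `ℝⁿ`. -/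
abbrev GLin (n : ℕ) : Type := E n ≃ₗ[ℝ] E n

/-- The projection `(A, v) ↦ A` from `Aff(ℝⁿ)` to `GL(n)`. -/
abbrev linPart (n : ℕ) : Aff n →* GLin n := AffineEquiv.linearHom

/-- The orthogonal group `O(n)`, as a subgroup of `GL(n)`. -/
def orthGroup (n : ℕ) : Subgroup (GLin n) where
  carrier := {B | ∀ x, ‖B x‖ = ‖x‖}
  mul_mem' := by
    intro B C hB hC x
    rw [LinearEquiv.mul_apply, hB, hC]
  one_mem' := fun _ => rfl
  inv_mem' := by
    intro B hB x
    rw [← hB (B⁻¹ x), ← LinearEquiv.mul_apply, mul_inv_cancel]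
    rfl

/-- `π` consists of rigid motions, i.e. `π ⊆ Iso(ℝⁿ) = O(n) ⋉ ℝⁿ`. -/
def IsRigid {n : ℕ} (π : Subgroup (Aff n)) : Prop :=
  ∀ γ ∈ π, linPart n γ ∈ orthGroup n

/-- The linear map underlying an element of `GL(n)`, as a point of the normed space of
endomorphisms of `ℝⁿ`. -/
def toEnd {n : ℕ} (A : GLin n) : E n →L[ℝ] E n :=
  LinearMap.toContinuousLinearMap (A : E n →ₗ[ℝ] E n)

/-- The pair `(A, v)` of the affine transformation `x ↦ A x + v`; it gives `Aff(ℝⁿ)` its topology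
as a subspace of `End(ℝⁿ) × ℝⁿ`. -/
def affPair {n : ℕ} (γ : Aff n) : (E n →L[ℝ] E n) × E n := (toEnd (linPart n γ), γ 0)

/-- A crystallographic group: a discrete group of rigid motions of `ℝⁿ` such that the translates of
some compact set cover `ℝⁿ`. -/
structure IsCrystallographic {n : ℕ} (π : Subgroup (Aff n)) : Prop where
  rigid : IsRigid π
  discrete : DiscreteTopology (affPair '' (π : Set (Aff n)))
  cocompact : ∃ K : Set (E n), IsCompact K ∧ ∀ x, ∃ γ ∈ π, γ x ∈ K

/-! ### Holonomy, the cone `C_π`, Teichmüller space, and the group `N_π` -/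

/-- The holonomy group `H_π`. -/
def holonomy {n : ℕ} (π : Subgroup (Aff n)) : Subgroup (GLin n) := π.map (linPart n)

/-- `C_π = {A ∈ GL(n) : A H_π A⁻¹ ⊆ O(n)}`. -/
def cone {n : ℕ} (π : Subgroup (Aff n)) : Set (GLin n) :=
  {A | ∀ h ∈ holonomy π, A * h * A⁻¹ ∈ orthGroup n}

/-- `N_π`, the linear part of the normalizer of `π` in `Aff(ℝⁿ)`. -/
def linNormalizer {n : ℕ} (π : Subgroup (Aff n)) : Subgroup (GLin n) :=
  (Subgroup.normalizer (π : Set (Aff n))).map (linPart n)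

theorem conj_mem_holonomy {n : ℕ} {π : Subgroup (Aff n)} {C h : GLin n}
    (hC : C ∈ linNormalizer π) (hh : h ∈ holonomy π) : C * h * C⁻¹ ∈ holonomy π := by
  obtain ⟨c, hc, rfl⟩ := hC
  obtain ⟨γ, hγ, rfl⟩ := hh
  exact ⟨c * γ * c⁻¹, (Subgroup.mem_set_normalizer_iff.1 hc γ).1 hγ, by simp only [map_mul, map_inv]⟩

/-- The left action of `O(n)` on `C_π` by multiplication. -/
instance coneLeftAction {n : ℕ} (π : Subgroup (Aff n)) : MulAction (orthGroup n) (cone π) where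
  smul B A := ⟨B.1 * A.1, fun h hh => by
    have := mul_mem (mul_mem B.2 (A.2 h hh)) (inv_mem B.2)
    simpa [mul_assoc] using this⟩
  one_smul A := Subtype.ext (one_mul A.1)
  mul_smul B C A := Subtype.ext (mul_assoc B.1 C.1 A.1)

/-- The right action of `N_π` on `C_π` by multiplication. -/
instance coneRightAction {n : ℕ} (π : Subgroup (Aff n)) :
    MulAction (linNormalizer π)ᵐᵒᵖ (cone π) where
  smul C A := ⟨A.1 * C.unop.1, fun h hh => by
    have := A.2 _ (conj_mem_holonomy C.unop.2 hh)
    simpa [mul_assoc] using this⟩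
  one_smul A := Subtype.ext (mul_one A.1)
  mul_smul C D A := Subtype.ext (mul_assoc A.1 D.unop.1 C.unop.1).symm

/-- The Teichmüller space `O(n) \ C_π`. -/
abbrev Teichmuller {n : ℕ} (π : Subgroup (Aff n)) : Type :=
  MulAction.orbitRel.Quotient (orthGroup n) (cone π)

/-- The class in Teichmüller space of an element of `C_π`. -/
def Teichmuller.mk {n : ℕ} {π : Subgroup (Aff n)} (A : cone π) : Teichmuller π :=
  Quotient.mk _ A

/-- The right action of `N_π` on Teichmüller space induced by right multiplication on `C_π`. -/
instance teichmullerRightAction {n : ℕ} (π : Subgroup (Aff n)) :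
    MulAction (linNormalizer π)ᵐᵒᵖ (Teichmuller π) where
  smul C := Quotient.map (fun A => C • A) (by
    rintro _ A ⟨B, rfl⟩
    exact ⟨B, Subtype.ext (mul_assoc B.1 A.1 C.unop.1).symm⟩)
  one_smul := by
    rintro ⟨A⟩
    exact congrArg (Quotient.mk _) (one_smul _ A)
  mul_smul C D := by
    rintro ⟨A⟩
    exact congrArg (Quotient.mk _) (mul_smul C D A)

/-- The quotient of Teichmüller space by `N_π`. -/
abbrev TeichmullerQuotient {n : ℕ} (π : Subgroup (Aff n)) : Type :=
  MulAction.orbitRel.Quotient (linNormalizer π)ᵐᵒᵖ (Teichmuller π)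

/-- The class of a point of Teichmüller space modulo `N_π`. -/
def TeichmullerQuotient.mk {n : ℕ} {π : Subgroup (Aff n)} (t : Teichmuller π) :
    TeichmullerQuotient π :=
  Quotient.mk _ t

/-! ### Flat metrics on `ℝⁿ/π` and their isometries -/

/-- The equivalence relation on `ℝⁿ` whose classes are the `π`-orbits. -/
def orbitSetoid {n : ℕ} (π : Subgroup (Aff n)) : Setoid (E n) where
  r x y := ∃ γ ∈ π, γ x = y
  iseqv :=
    { refl := fun x => ⟨1, one_mem π, rfl⟩
      symm := by
        rintro x _ ⟨γ, hγ, rfl⟩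
        exact ⟨γ⁻¹, inv_mem hγ, γ.symm_apply_apply x⟩
      trans := by
        rintro x _ _ ⟨γ, hγ, rfl⟩ ⟨δ, hδ, rfl⟩
        exact ⟨δ * γ, mul_mem hδ hγ, rfl⟩ }

/-- The underlying topological space `ℝⁿ/π` of the orbifold, with the quotient topology. -/
abbrev Space {n : ℕ} (π : Subgroup (Aff n)) : Type := Quotient (orbitSetoid π)

/-- The projection `ℝⁿ → ℝⁿ/π`. -/
def proj {n : ℕ} (π : Subgroup (Aff n)) (x : E n) : Space π := Quotient.mk (orbitSetoid π) x

/-- A flat Riemannian metric on the orbifold `ℝⁿ/π`: a smooth Riemannian metric on `ℝⁿ` which is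
invariant under `π` and locally isometric to the Euclidean metric. -/
structure FlatMetric {n : ℕ} (π : Subgroup (Aff n)) where
  /-- The inner product `g_x` on the tangent space at `x`. -/
  form : E n → E n →L[ℝ] E n →L[ℝ] ℝ
  smooth : ContDiff ℝ ∞ form
  symm : ∀ x u v, form x u v = form x v u
  pos : ∀ x u, u ≠ 0 → 0 < form x u u
  invariant : ∀ γ ∈ π, ∀ x u v, form (γ x) (linPart n γ u) (linPart n γ v) = form x u v
  flat : ∀ x, ∃ φ : OpenPartialHomeomorph (E n) (E n), x ∈ φ.source ∧
    ContDiffOn ℝ ∞ φ φ.source ∧ ContDiffOn ℝ ∞ φ.symm φ.target ∧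
    ∀ z ∈ φ.source, ∀ u v, inner ℝ (fderiv ℝ φ z u) (fderiv ℝ φ z v) = form z u v

/-- The metric `g_π` on `ℝⁿ/π` induced by the Euclidean metric of `ℝⁿ`, for a group `π` of rigid
motions. -/
def euclideanMetric {n : ℕ} (π : Subgroup (Aff n)) (hπ : IsRigid π) : FlatMetric π where
  form _ := innerSL ℝ
  smooth := contDiff_const
  symm _ u v := real_inner_comm v u
  pos _ u hu := real_inner_self_pos.2 hu
  invariant γ hγ _ u v :=
    (LinearIsometryEquiv.mk (linPart n γ) (hπ γ hγ)).inner_map_map u v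
  flat x := ⟨OpenPartialHomeomorph.refl _, by simp, contDiffOn_id, contDiffOn_id,
    fun z _ u v => by simp; rfl⟩

/-- `f : ℝⁿ/π → ℝⁿ/π'` is an isometry of orbifolds from `g` to `g'`: a homeomorphism such that, for
all points `x` and `y` of `ℝⁿ` with `f [x] = [y]`, there is a diffeomorphism `F` between open
neighbourhoods of `x` and `y` that lifts `f`, maps `x` to `y` and pulls `g'` back to `g`. -/
def IsOrbifoldIsometry {n : ℕ} {π π' : Subgroup (Aff n)} (g : FlatMetric π) (g' : FlatMetric π')
    (f : Space π ≃ₜ Space π') : Prop :=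
  ∀ x y, f (proj π x) = proj π' y →
    ∃ F : OpenPartialHomeomorph (E n) (E n), x ∈ F.source ∧ F x = y ∧
      ContDiffOn ℝ ∞ F F.source ∧ ContDiffOn ℝ ∞ F.symm F.target ∧
      ∀ z ∈ F.source, proj π' (F z) = f (proj π z) ∧
        ∀ u v, g'.form (F z) (fderiv ℝ F z u) (fderiv ℝ F z v) = g.form z u v

/-- The orbifolds `(ℝⁿ/π, g)` and `(ℝⁿ/π', g')` are isometric. -/
def Isometric {n : ℕ} {π π' : Subgroup (Aff n)} (g : FlatMetric π) (g' : FlatMetric π') : Prop :=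
  ∃ f : Space π ≃ₜ Space π', IsOrbifoldIsometry g g' f

theorem Isometric.refl {n : ℕ} {π : Subgroup (Aff n)} (g : FlatMetric π) : Isometric g g := by
  refine ⟨Homeomorph.refl _, fun x y hxy => ?_⟩
  obtain ⟨γ, hγ, rfl⟩ : ∃ γ ∈ π, γ x = y := Quotient.exact hxy
  have hd : ∀ z, HasFDerivAt γ (toEnd (linPart n γ)) z := fun z => by
    have h1 : (γ : E n → E n) = fun w => toEnd (linPart n γ) w + γ 0 := by
      funext w
      have := γ.map_vadd 0 w
      simp only [vadd_eq_add, add_zero] at this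
      exact this
    rw [h1]
    exact (toEnd (linPart n γ)).hasFDerivAt.add_const _
  have hs : ∀ δ : Aff n, ContDiff ℝ ∞ δ := fun δ => by
    have h1 : (δ : E n → E n) = fun w => toEnd (linPart n δ) w + δ 0 := by
      funext w
      have := δ.map_vadd 0 w
      simp only [vadd_eq_add, add_zero] at this
      exact this
    rw [h1]
    exact (toEnd (linPart n δ)).contDiff.add contDiff_const
  refine ⟨(Homeomorph.mk γ.toEquiv (hs γ).continuous (hs γ.symm).continuous).toOpenPartialHomeomorph,
    trivial, rfl, (hs γ).contDiffOn, (hs γ.symm).contDiffOn, fun z _ => ⟨?_, fun u v => ?_⟩⟩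
  · exact (Quotient.sound ⟨γ, hγ, rfl⟩ : proj π z = proj π (γ z)).symm
  · change g.form (γ z) (fderiv ℝ γ z u) (fderiv ℝ γ z v) = _
    rw [(hd z).fderiv]
    exact g.invariant γ hγ z u v

theorem Isometric.symm {n : ℕ} {π π' : Subgroup (Aff n)} {g : FlatMetric π} {g' : FlatMetric π'}
    (h : Isometric g g') : Isometric g' g := by
  obtain ⟨f, hf⟩ := h
  refine ⟨f.symm, fun y x hyx => ?_⟩
  obtain ⟨F, hx, hFx, hF, hF', hlift⟩ := hf x y (by rw [← hyx, f.apply_symm_apply])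
  refine ⟨F.symm, by simpa [hFx] using F.map_source hx, by rw [← hFx, F.left_inv hx], by simpa,
    by simpa, fun w hw => ?_⟩
  have hw' : w ∈ F.target := by simpa using hw
  have hz := F.map_target hw'
  obtain ⟨h1, h2⟩ := hlift _ hz
  rw [F.right_inv hw'] at h1 h2
  refine ⟨by rw [h1, f.symm_apply_apply], fun u v => ?_⟩
  have d1 : DifferentiableAt ℝ F (F.symm w) :=
    (hF.contDiffAt (F.open_source.mem_nhds hz)).differentiableAt (by simp)
  have d2 : DifferentiableAt ℝ F.symm w :=
    (hF'.contDiffAt (F.open_target.mem_nhds hw')).differentiableAt (by simp)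
  have hid : (fderiv ℝ F (F.symm w)).comp (fderiv ℝ F.symm w) = ContinuousLinearMap.id ℝ _ := by
    rw [← fderiv_comp w d1 d2, ← fderiv_id (𝕜 := ℝ) (x := w)]
    apply Filter.EventuallyEq.fderiv_eq
    filter_upwards [F.open_target.mem_nhds hw'] with t ht using F.right_inv ht
  have hid' : ∀ u, fderiv ℝ F (F.symm w) (fderiv ℝ F.symm w u) = u := fun u =>
    DFunLike.congr_fun hid u
  rw [← h2, hid', hid']

theorem Isometric.trans {n : ℕ} {π π' π'' : Subgroup (Aff n)} {g : FlatMetric π}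
    {g' : FlatMetric π'} {g'' : FlatMetric π''} (h : Isometric g g') (h' : Isometric g' g'') :
    Isometric g g'' := by
  obtain ⟨f, hf⟩ := h
  obtain ⟨f', hf'⟩ := h'
  refine ⟨f.trans f', fun x z hxz => ?_⟩
  obtain ⟨y, hy⟩ : ∃ y, proj π' y = f (proj π x) := Quotient.exists_rep _
  obtain ⟨F, hx, hFx, hF, hFs, hlift⟩ := hf x y hy.symm
  obtain ⟨G, hy', hGy, hG, hGs, hlift'⟩ := hf' y z (by rw [hy]; exact hxz)
  refine ⟨F.trans G, by simp [hx, hFx, hy'], by simp [hFx, hGy], ?_, ?_, ?_⟩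
  · rw [F.trans_source, F.coe_trans]
    exact hG.comp (hF.mono Set.inter_subset_left) (fun _ ht => ht.2)
  · rw [F.trans_target, F.coe_trans_symm]
    exact hFs.comp (hGs.mono Set.inter_subset_left) (fun _ ht => ht.2)
  · intro w hw
    rw [F.trans_source] at hw
    obtain ⟨h1, h2⟩ := hlift w hw.1
    obtain ⟨h3, h4⟩ := hlift' (F w) hw.2
    refine ⟨by simp [h3, h1], fun u v => ?_⟩
    have d1 : DifferentiableAt ℝ F w :=
      (hF.contDiffAt (F.open_source.mem_nhds hw.1)).differentiableAt (by simp)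
    have d2 : DifferentiableAt ℝ G (F w) :=
      (hG.contDiffAt (G.open_source.mem_nhds hw.2)).differentiableAt (by simp)
    rw [F.coe_trans, fderiv_comp w d2 d1]
    simp only [ContinuousLinearMap.comp_apply, Function.comp_apply]
    rw [h4, h2]

/-- Isometry of flat metrics on `ℝⁿ/π`, as an equivalence relation. -/
def isometrySetoid {n : ℕ} (π : Subgroup (Aff n)) : Setoid (FlatMetric π) where
  r := Isometric
  iseqv := ⟨Isometric.refl, Isometric.symm, Isometric.trans⟩

/-- The moduli space of isometry classes of flat metrics on `ℝⁿ/π`. -/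
abbrev Moduli {n : ℕ} (π : Subgroup (Aff n)) : Type := Quotient (isometrySetoid π)

/-- The isometry class of a flat metric. -/
def Moduli.mk {n : ℕ} {π : Subgroup (Aff n)} (g : FlatMetric π) : Moduli π :=
  Quotient.mk (isometrySetoid π) g

/-- The conjugate group `a π a⁻¹`. -/
def conjGroup {n : ℕ} (a : Aff n) (π : Subgroup (Aff n)) : Subgroup (Aff n) :=
  π.map (MulAut.conj a).toMonoidHom

theorem isRigid_conjGroup {n : ℕ} {π : Subgroup (Aff n)} {a : Aff n} (ha : linPart n a ∈ cone π) :
    IsRigid (conjGroup a π) := by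
  rintro _ ⟨γ, hγ, rfl⟩
  have := ha _ ⟨γ, hγ, rfl⟩
  rwa [← map_inv, ← map_mul, ← map_mul] at this

end FlatOrbifold

end

open scoped ContDiff

noncomputable section

namespace FlatOrbifold

open Filter Topology Metric Set

variable {n : ℕ}

/-! ### Affine transformations and their linear parts -/

/-! Up to isometry, every flat metric on `ℝⁿ/π` is a constant one, `⟨A u, A v⟩` with `A` in `cone
π`. The theorem then amounts to deciding when two constant metrics are isometric.

Reduction to constant metrics. Since `π` is cocompact, a flat metric `g` has isometric charts whose
images contain balls of a uniform radius, so `g` is complete and its developing map `D` is an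
isometry onto Euclidean space (`FlatMetric.exists_developing`). Conjugation by `D` turns `π` into
another proper cocompact group of rigid motions. By Bieberbach's second theorem
(`IsProperCocompact.exists_affine_conj`) this isomorphism is conjugation by an affine `a`. The
linear part of `a` lies in `cone π`, and both `g` and the constant metric of `a` are isometric to
the Euclidean metric of `a π a⁻¹`.

Comparison. An isometry between Euclidean orbifolds lifts to one rigid motion `T`
(`exists_rigid_conj`): local lifts are rigid, and two of them differ by an element of a countable
group. If `T` carries `a π a⁻¹` to `a' π a'⁻¹`, then `a'⁻¹ T a` normalizes `π`. On linear parts this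
reads `B A = A' C` with `B` orthogonal and `C` in `N_π`, which is the equivalence relation of `O(n)
\ C_π / N_π`.

Both Bieberbach theorems rest on `IsProperCocompact.linPart_eq_one`: an element whose linear part is
within `1/2` of the identity is a translation. Hence the holonomy is finite and the translations
form a full lattice. `N_π` preserves that lattice, which makes it discrete. For the second theorem,
the map of lattices extends linearly, and averaging over a finite quotient supplies the translation
part. -/

theorem toEnd_apply (A : GLin n) (x : E n) : toEnd A x = A x := rfl

theorem aff_apply (γ : Aff n) (x : E n) : γ x = linPart n γ x + γ 0 := by
  have := γ.map_vadd 0 x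
  simp only [vadd_eq_add, add_zero] at this
  exact this

theorem aff_mul_apply (γ δ : Aff n) (x : E n) : (γ * δ) x = γ (δ x) := rfl

theorem aff_inv_apply_self (γ : Aff n) (x : E n) : γ⁻¹ (γ x) = x := γ.symm_apply_apply x

theorem aff_apply_inv_self (γ : Aff n) (x : E n) : γ (γ⁻¹ x) = x := γ.apply_symm_apply x

theorem linPart_inv_apply_self (γ : Aff n) (x : E n) :
    linPart n γ⁻¹ (linPart n γ x) = x := by
  rw [← LinearEquiv.mul_apply, ← map_mul, inv_mul_cancel, map_one]; rfl

theorem linPart_apply_inv_self (γ : Aff n) (x : E n) :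
    linPart n γ (linPart n γ⁻¹ x) = x := by
  rw [← LinearEquiv.mul_apply, ← map_mul, mul_inv_cancel, map_one]; rfl

theorem linPart_mul_apply (γ δ : Aff n) (x : E n) :
    linPart n (γ * δ) x = linPart n γ (linPart n δ x) := by
  rw [map_mul]; rfl

theorem aff_apply_sub (γ : Aff n) (x y : E n) : γ x - γ y = linPart n γ (x - y) := by
  rw [aff_apply γ x, aff_apply γ y, map_sub]; abel

theorem aff_apply_add (γ : Aff n) (x y : E n) : γ (x + y) = γ x + linPart n γ y := by
  rw [aff_apply γ (x + y), aff_apply γ x, map_add]; abel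

theorem aff_ext {γ δ : Aff n} (h1 : linPart n γ = linPart n δ) (h0 : γ 0 = δ 0) : γ = δ := by
  ext1 x
  rw [aff_apply γ, aff_apply δ, h1, h0]

theorem contDiff_aff (γ : Aff n) : ContDiff ℝ ∞ γ := by
  have h1 : (γ : E n → E n) = fun w => toEnd (linPart n γ) w + γ 0 :=
    funext fun w => aff_apply γ w
  rw [h1]
  exact (toEnd (linPart n γ)).contDiff.add contDiff_const

theorem fderiv_aff (γ : Aff n) (z : E n) : fderiv ℝ γ z = toEnd (linPart n γ) := by
  have h1 : (γ : E n → E n) = fun w => toEnd (linPart n γ) w + γ 0 :=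
    funext fun w => aff_apply γ w
  rw [h1]
  exact ((toEnd (linPart n γ)).hasFDerivAt.add_const _).fderiv

/-- The affine transformation `x ↦ A x + v`. -/
def mkAff (A : GLin n) (v : E n) : Aff n :=
  A.toAffineEquiv.trans (AffineEquiv.constVAdd ℝ (E n) v)

theorem mkAff_apply (A : GLin n) (v x : E n) : mkAff A v x = A x + v := by
  simp [mkAff, add_comm]

theorem linPart_mkAff (A : GLin n) (v : E n) : linPart n (mkAff A v) = A := by
  ext1 x
  have h := aff_apply (mkAff A v) x
  rw [mkAff_apply, mkAff_apply, map_zero, zero_add] at h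
  exact (add_right_cancel h).symm

/-- Translation by `v`. -/
abbrev transl (v : E n) : Aff n := mkAff 1 v

theorem transl_apply (v x : E n) : transl v x = x + v := mkAff_apply 1 v x

theorem linPart_transl (v : E n) : linPart n (transl v) = 1 := linPart_mkAff 1 v

theorem eq_transl {γ : Aff n} (h : linPart n γ = 1) : γ = transl (γ 0) :=
  aff_ext (by rw [h, linPart_transl]) (by rw [transl_apply, zero_add])

theorem transl_add (v w : E n) : transl (v + w) = transl v * transl w := by
  ext1 x
  rw [aff_mul_apply, transl_apply, transl_apply, transl_apply]; abel

theorem transl_zero : transl (0 : E n) = 1 := by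
  ext1 x
  rw [transl_apply, add_zero]; rfl

theorem transl_neg (v : E n) : transl (-v) = (transl v)⁻¹ := by
  rw [eq_inv_iff_mul_eq_one, ← transl_add, neg_add_cancel, transl_zero]

theorem transl_nsmul (k : ℕ) (v : E n) : transl (k • v) = transl v ^ k := by
  induction k with
  | zero => rw [zero_smul, pow_zero, transl_zero]
  | succ k ih => rw [succ_nsmul, transl_add, ih, pow_succ]

theorem conj_transl (γ : Aff n) (v : E n) :
    γ * transl v * γ⁻¹ = transl (linPart n γ v) := by
  ext1 x
  rw [aff_mul_apply, aff_mul_apply, transl_apply, transl_apply, aff_apply_add, aff_apply_inv_self]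

/-! ### Groups of rigid motions -/

/-- The linear isometry given by an orthogonal transformation. -/
def orthIsometry {A : GLin n} (hA : A ∈ orthGroup n) : E n ≃ₗᵢ[ℝ] E n := ⟨A, hA⟩

/-- A group of rigid motions which acts properly on `ℝⁿ` with compact quotient. -/
structure IsProperCocompact (π : Subgroup (Aff n)) : Prop where
  rigid : IsRigid π
  proper : ∀ R : ℝ, {γ | γ ∈ π ∧ ‖γ 0‖ ≤ R}.Finite
  cocompact : ∃ K : Set (E n), IsCompact K ∧ ∀ x, ∃ γ ∈ π, γ x ∈ K

theorem norm_toEnd_le_one {A : GLin n} (hA : A ∈ orthGroup n) : ‖toEnd A‖ ≤ 1 :=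
  ContinuousLinearMap.opNorm_le_bound _ zero_le_one fun x => by
    rw [toEnd_apply, hA x, one_mul]

theorem toEnd_mul (A B : GLin n) : toEnd (A * B) = toEnd A * toEnd B := rfl

theorem toEnd_one : toEnd (1 : GLin n) = 1 := rfl

theorem toEnd_injective : Function.Injective (toEnd : GLin n → _) := by
  intro A B h
  ext1 x
  exact DFunLike.congr_fun h x

theorem norm_toEnd_inv_mul_sub_one {A B : GLin n} (hA : A ∈ orthGroup n) :
    ‖toEnd (A⁻¹ * B) - 1‖ ≤ ‖toEnd B - toEnd A‖ := by
  have h : toEnd (A⁻¹ * B) - 1 = toEnd A⁻¹ * (toEnd B - toEnd A) := by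
    rw [mul_sub, ← toEnd_mul, ← toEnd_mul, inv_mul_cancel, toEnd_one]
  rw [h]
  refine (norm_mul_le _ _).trans ?_
  exact mul_le_of_le_one_left (norm_nonneg _) (norm_toEnd_le_one (inv_mem hA))

theorem norm_toEnd_mul_inv_sub_one {A B : GLin n} (hA : A ∈ orthGroup n) :
    ‖toEnd (B * A⁻¹) - 1‖ ≤ ‖toEnd B - toEnd A‖ := by
  have h : toEnd (B * A⁻¹) - 1 = (toEnd B - toEnd A) * toEnd A⁻¹ := by
    rw [sub_mul, ← toEnd_mul, ← toEnd_mul, mul_inv_cancel, toEnd_one]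
  rw [h]
  refine (norm_mul_le _ _).trans ?_
  exact mul_le_of_le_one_right (norm_nonneg _) (norm_toEnd_le_one (inv_mem hA))

/-- In an infinite subset of a totally bounded set there are distinct points arbitrarily close to
each other. -/
theorem exists_ne_dist_lt_of_infinite {X : Type*} [PseudoMetricSpace X] {s t : Set X}
    (ht : TotallyBounded t) (hst : s ⊆ t) (hs : s.Infinite) {ε : ℝ} (hε : 0 < ε) :
    ∃ x ∈ s, ∃ y ∈ s, x ≠ y ∧ dist x y < ε := by
  obtain ⟨c, hc, hcov⟩ := Metric.totallyBounded_iff.1 (ht.subset hst) (ε / 2) (half_pos hε)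
  have : ∃ y ∈ c, (s ∩ ball y (ε / 2)).Infinite := by
    by_contra! hcon
    refine hs ((hc.biUnion fun y hy => hcon y hy).subset fun x hx => ?_)
    obtain ⟨y, hy, hxy⟩ := mem_iUnion₂.1 (hcov hx)
    exact mem_iUnion₂.2 ⟨y, hy, hx, hxy⟩
  obtain ⟨y, -, hy⟩ := this
  obtain ⟨a, ha, b, hb, hab⟩ := hy.nontrivial
  refine ⟨a, ha.1, b, hb.1, hab, ?_⟩
  have h1 := mem_ball.1 ha.2
  have h2 := mem_ball'.1 hb.2
  linarith [dist_triangle a y b]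

theorem affPair_injective : Function.Injective (affPair : Aff n → _) := by
  intro γ δ h
  exact aff_ext (toEnd_injective (congrArg Prod.fst h)) (congrArg Prod.snd h)

/-- Orthogonal parts are bounded, so infinitely many elements with bounded translation would include
two distinct ones arbitrarily close together. Multiplying by the rigid `γ⁻¹` moves such a pair next
to the identity, which is isolated. -/
theorem IsCrystallographic.isProperCocompact {π : Subgroup (Aff n)} (h : IsCrystallographic π) :
    IsProperCocompact π := by
  refine ⟨h.rigid, fun R => ?_, h.cocompact⟩
  obtain ⟨ε, hε, hsep⟩ : ∃ ε > 0, ∀ γ ∈ π, dist (affPair γ) (affPair 1) < ε → γ = 1 := by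
    have hd := h.discrete
    have h1 : affPair 1 ∈ affPair '' (π : Set (Aff n)) := ⟨1, one_mem π, rfl⟩
    obtain ⟨ε, hε, hball⟩ := Metric.exists_ball_inter_eq_singleton_of_mem_discrete ⟨hd⟩ h1
    refine ⟨ε, hε, fun γ hγ hlt => ?_⟩
    have : affPair γ ∈ ball (affPair 1) ε ∩ affPair '' (π : Set (Aff n)) := ⟨hlt, γ, hγ, rfl⟩
    rw [hball] at this
    exact affPair_injective this
  by_contra hinf
  have hinf' : (affPair '' {γ | γ ∈ π ∧ ‖γ 0‖ ≤ R}).Infinite :=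
    Set.Infinite.image affPair_injective.injOn hinf
  have hsub : affPair '' {γ | γ ∈ π ∧ ‖γ 0‖ ≤ R} ⊆
      closedBall (0 : E n →L[ℝ] E n) 1 ×ˢ closedBall (0 : E n) R := by
    rintro _ ⟨γ, ⟨hγ, hR⟩, rfl⟩
    exact ⟨by simpa [affPair] using norm_toEnd_le_one (h.rigid γ hγ), by simpa [affPair] using hR⟩
  obtain ⟨_, ⟨γ, hγ, rfl⟩, _, ⟨δ, hδ, rfl⟩, hne, hlt⟩ := exists_ne_dist_lt_of_infinite
    ((isCompact_closedBall _ _).prod (isCompact_closedBall _ _)).totallyBounded hsub hinf' hε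
  refine hne (congrArg affPair ?_)
  have hpair : ‖toEnd (linPart n δ) - toEnd (linPart n γ)‖ < ε ∧ ‖δ 0 - γ 0‖ < ε := by
    rw [dist_comm, Prod.dist_eq, max_lt_iff, dist_eq_norm, dist_eq_norm] at hlt
    exact hlt
  have := hsep (γ⁻¹ * δ) (mul_mem (inv_mem hγ.1) hδ.1) ?_
  · exact inv_mul_eq_one.1 this
  · rw [Prod.dist_eq, max_lt_iff, dist_eq_norm, dist_eq_norm]
    constructor
    · change ‖toEnd (linPart n (γ⁻¹ * δ)) - toEnd (linPart n 1)‖ < ε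
      rw [map_mul, map_inv, map_one, toEnd_one]
      exact (norm_toEnd_inv_mul_sub_one (h.rigid γ hγ.1)).trans_lt hpair.1
    · change ‖(γ⁻¹ * δ) 0 - (1 : Aff n) 0‖ < ε
      have : (1 : Aff n) 0 = γ⁻¹ (γ 0) := (aff_inv_apply_self γ 0).symm
      rw [aff_mul_apply, this, aff_apply_sub, h.rigid γ⁻¹ (inv_mem hγ.1)]
      exact hpair.2

theorem IsProperCocompact.countable {π : Subgroup (Aff n)} (h : IsProperCocompact π) :
    (π : Set (Aff n)).Countable := by
  have : (π : Set (Aff n)) ⊆ ⋃ k : ℕ, {γ | γ ∈ π ∧ ‖γ 0‖ ≤ k} := fun γ hγ => by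
    obtain ⟨k, hk⟩ := exists_nat_ge ‖γ 0‖
    exact mem_iUnion.2 ⟨k, hγ, hk⟩
  exact (countable_iUnion fun k : ℕ => (h.proper k).countable).mono this

/-- Among the elements of `π` with a given property there is one which moves the origin least. -/
theorem IsProperCocompact.exists_min {π : Subgroup (Aff n)} (h : IsProperCocompact π)
    {P : Aff n → Prop} (hP : ∃ γ ∈ π, P γ) :
    ∃ γ ∈ π, P γ ∧ ∀ δ ∈ π, P δ → ‖γ 0‖ ≤ ‖δ 0‖ := by
  obtain ⟨γ₀, h₀, hP₀⟩ := hP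
  have hfin : {γ | γ ∈ π ∧ P γ ∧ ‖γ 0‖ ≤ ‖γ₀ 0‖}.Finite :=
    (h.proper ‖γ₀ 0‖).subset fun γ hγ => ⟨hγ.1, hγ.2.2⟩
  obtain ⟨γ, hγ, hmin⟩ := Set.exists_min_image _ (fun γ : Aff n => ‖γ 0‖) hfin ⟨γ₀, h₀, hP₀, le_rfl⟩
  refine ⟨γ, hγ.1, hγ.2.1, fun δ hδ hPδ => ?_⟩
  rcases le_total ‖δ 0‖ ‖γ₀ 0‖ with hle | hle
  · exact hmin δ ⟨hδ, hPδ, hle⟩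
  · exact hγ.2.2.trans hle

/-- A cocompact group of rigid motions contains elements with almost trivial linear part that
translate in almost any given direction. -/
theorem IsProperCocompact.exists_almost_translation {π : Subgroup (Aff n)}
    (h : IsProperCocompact π) (u : E n) {ε : ℝ} (hε : 0 < ε) :
    ∃ β ∈ π, ∃ t : ℝ, 0 < t ∧ ‖toEnd (linPart n β) - 1‖ ≤ ε ∧ ‖β 0 - t • u‖ ≤ ε * t := by
  -- Take `β k` carrying `0` to within bounded distance of `k • u`. The linear parts accumulate, so
  -- for suitable `i < j` the quotient `β j * (β i)⁻¹` hardly rotates and translates by about `(j -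
  -- i) • u`.
  obtain ⟨K, hK, hcov⟩ := h.cocompact
  obtain ⟨d, hd⟩ := hK.isBounded.exists_norm_le
  have hex : ∀ k : ℕ, ∃ β ∈ π, ‖β 0 - (k : ℝ) • u‖ ≤ d := fun k => by
    obtain ⟨γ, hγ, hγK⟩ := hcov ((k : ℝ) • u)
    refine ⟨γ⁻¹, inv_mem hγ, ?_⟩
    have h1 : (k : ℝ) • u = γ⁻¹ (γ ((k : ℝ) • u)) := (aff_inv_apply_self _ _).symm
    rw [h1, aff_apply_sub, h.rigid _ (inv_mem hγ), zero_sub, norm_neg]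
    exact hd _ hγK
  choose β hβ hβd using hex
  have hbdd : Bornology.IsBounded (closedBall (0 : E n →L[ℝ] E n) 1) := isBounded_closedBall
  obtain ⟨L, -, φ, hφ, hlim⟩ := tendsto_subseq_of_bounded hbdd
    (x := fun k => toEnd (linPart n (β k)))
    (fun k => by simpa using norm_toEnd_le_one (h.rigid _ (hβ k)))
  obtain ⟨N, hN⟩ := Metric.cauchySeq_iff'.1 hlim.cauchySeq ε hε
  set i := φ N
  -- With `i` fixed, the error of the translation is at most `2 * d + ε * ‖β i 0‖`; `j` is taken so
  -- large that `ε * (j - i)` exceeds it.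
  obtain ⟨T, hT⟩ := exists_nat_gt ((2 * d + ε * ‖β i 0‖) / ε + i)
  set j := φ (max N (T + 1))
  have hjT : (T : ℝ) < j := by
    have : T + 1 ≤ j := (le_max_right N _).trans (hφ.id_le _)
    exact_mod_cast this
  have hrot : ‖toEnd (linPart n (β j * (β i)⁻¹)) - 1‖ ≤ ε := by
    rw [map_mul, map_inv]
    refine (norm_toEnd_mul_inv_sub_one (h.rigid _ (hβ i))).trans ?_
    have := hN (max N (T + 1)) (le_max_left _ _)
    rw [dist_eq_norm] at this
    exact this.le
  have hd0 : 0 ≤ d := (norm_nonneg _).trans (hβd 0)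
  have hq : 0 ≤ (2 * d + ε * ‖β i 0‖) / ε := by positivity
  have hij : (2 * d + ε * ‖β i 0‖) / ε < (j : ℝ) - i := by linarith
  refine ⟨β j * (β i)⁻¹, mul_mem (hβ j) (inv_mem (hβ i)), j - i, by linarith, hrot, ?_⟩
  have key : (β j * (β i)⁻¹) 0 - ((j : ℝ) - i) • u =
      (β j 0 - (j : ℝ) • u) - (β i 0 - (i : ℝ) • u)
        - (toEnd (linPart n (β j * (β i)⁻¹)) - 1) (β i 0) := by
    have h1 : (β j * (β i)⁻¹) (β i 0) = β j 0 := by rw [aff_mul_apply, aff_inv_apply_self]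
    rw [aff_apply] at h1
    rw [← h1, sub_smul, sub_apply, toEnd_apply, one_apply_eq_self]
    abel
  rw [key]
  have e1 := norm_sub_le ((β j 0 - (j : ℝ) • u) - (β i 0 - (i : ℝ) • u))
    ((toEnd (linPart n (β j * (β i)⁻¹)) - 1) (β i 0))
  have e2 := norm_sub_le (β j 0 - (j : ℝ) • u) (β i 0 - (i : ℝ) • u)
  have e3 := ((toEnd (linPart n (β j * (β i)⁻¹)) - 1).le_opNorm (β i 0)).trans
    (mul_le_mul_of_nonneg_right hrot (norm_nonneg _))
  have e4 : 2 * d + ε * ‖β i 0‖ < ε * ((j : ℝ) - i) := by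
    rwa [div_lt_iff₀ hε, mul_comm _ ε] at hij
  linarith [hβd i, hβd j]

/-- On every subspace of a Euclidean space a linear map attains its norm. -/
theorem exists_norm_attained (N : E n →L[ℝ] E n) (F : Submodule ℝ (E n)) :
    ∃ c : ℝ, 0 ≤ c ∧ (∀ x ∈ F, ‖N x‖ ≤ c * ‖x‖) ∧
      (c = 0 ∨ ∃ u ∈ F, ‖u‖ = 1 ∧ ‖N u‖ = c) := by
  have hc : IsCompact (sphere (0 : E n) 1 ∩ F) :=
    (isCompact_sphere _ _).inter_right F.closed_of_finiteDimensional
  -- The intersection is empty only for the zero subspace, where `c = 0` serves.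
  rcases (sphere (0 : E n) 1 ∩ F).eq_empty_or_nonempty with he | hne
  · refine ⟨0, le_rfl, fun x hx => ?_, Or.inl rfl⟩
    by_cases hx0 : x = 0
    · simp [hx0]
    · have : ‖x‖⁻¹ • x ∈ sphere (0 : E n) 1 ∩ F :=
        ⟨by simp [norm_smul, hx0], F.smul_mem _ hx⟩
      rw [he] at this
      exact this.elim
  · obtain ⟨u, hu, hmax⟩ := hc.exists_isMaxOn hne (f := fun x => ‖N x‖) (by fun_prop)
    refine ⟨‖N u‖, norm_nonneg _, fun x hx => ?_, Or.inr ⟨u, hu.2, by simpa using hu.1, rfl⟩⟩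
    by_cases hx0 : x = 0
    · simp [hx0]
    · have hmem : ‖x‖⁻¹ • x ∈ sphere (0 : E n) 1 ∩ F :=
        ⟨by simp [norm_smul, hx0], F.smul_mem _ hx⟩
      have := hmax hmem
      simp only [mem_ofPred_eq, map_smul, norm_smul, norm_inv, norm_norm] at this
      rwa [inv_mul_le_iff₀ (norm_pos_iff.2 hx0), mul_comm] at this

/-- The splitting of Euclidean space into the vectors moved as far as possible by a nontrivial
orthogonal transformation, and their orthogonal complement. -/
theorem exists_maximal_rotation_splitting {A : GLin n} (hA : A ∈ orthGroup n) (hA1 : A ≠ 1) :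
    ∃ (F : Submodule ℝ (E n)) (u : E n) (m m' : ℝ), u ∈ F ∧ ‖u‖ = 1 ∧ 0 ≤ m' ∧ m' < m ∧
      m = ‖toEnd A - 1‖ ∧
      (∀ x ∈ F, A x - x ∈ F ∧ ‖A x - x‖ = m * ‖x‖) ∧
      (∀ x ∈ Fᗮ, A x - x ∈ Fᗮ ∧ ‖A x - x‖ ≤ m' * ‖x‖) := by
  set e := orthIsometry hA
  have hflip : ∀ x y, inner ℝ (A x) y = inner ℝ x (A.symm y) := fun x y =>
    e.inner_map_eq_flip x y
  set m := ‖toEnd A - 1‖ with hm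
  have hle : ∀ x, ‖A x - x‖ ≤ m * ‖x‖ := fun x => (toEnd A - 1).le_opNorm x
  have hmpos : 0 < m := by
    rw [hm, norm_pos_iff, sub_ne_zero]
    exact fun h => hA1 (toEnd_injective h)
  -- As `A.symm` is the adjoint of `A`, the operator `2 - (A + A.symm)` is `(A - 1)ᵀ(A - 1)`; `F` is
  -- its eigenspace for the top eigenvalue `m ^ 2`.
  let F : Submodule ℝ (E n) :=
    LinearMap.ker ((A : E n →ₗ[ℝ] E n) + (A.symm : E n →ₗ[ℝ] E n) - (2 - m ^ 2) • LinearMap.id)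
  have hF : ∀ x, x ∈ F ↔ A x + A.symm x = (2 - m ^ 2) • x := fun x => by
    simp [F, sub_eq_zero]
  have hsq : ∀ x, ‖A x - x‖ ^ 2 = 2 * ‖x‖ ^ 2 - inner ℝ (A x + A.symm x) x := fun x => by
    rw [norm_sub_sq_real, hA x, inner_add_left, real_inner_comm x (A.symm x), ← hflip x x]
    ring
  -- A vector at which `A - 1` attains its norm is an eigenvector: expanding `‖(A - 1)ᵀ(A - 1) x -
  -- m² x‖²` bounds it by `(m⁴ - 2 m⁴ + m⁴) ‖x‖² = 0`.
  have hFmem : ∀ x, ‖A x - x‖ = m * ‖x‖ → x ∈ F := fun x hx => by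
    rw [hF]
    have h1 : ‖(2 : ℝ) • x - (A x + A.symm x)‖ ≤ m * (m * ‖x‖) := by
      have : (2 : ℝ) • x - (A x + A.symm x) = A.symm (A x - x) - (A x - x) := by
        rw [map_sub, A.symm_apply_apply, two_smul]; abel
      rw [this, ← hx, ← norm_neg, neg_sub]
      have h2 := hle (A.symm (A x - x))
      rw [A.apply_symm_apply] at h2
      refine h2.trans_eq ?_
      rw [show ‖A.symm (A x - x)‖ = ‖A x - x‖ from e.symm.norm_map _]
    have h3 : ‖((2 : ℝ) • x - (A x + A.symm x)) - m ^ 2 • x‖ ^ 2 ≤ 0 := by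
      have h4 := hsq x
      rw [hx] at h4
      rw [norm_sub_sq_real, inner_smul_right, inner_sub_left, inner_smul_left, norm_smul,
        real_inner_self_eq_norm_sq]
      simp only [RCLike.conj_to_real, norm_pow, Real.norm_eq_abs, sq_abs]
      have h5 := pow_le_pow_left₀ (norm_nonneg _) h1 2
      have h6 : inner ℝ (A x + A.symm x) x = 2 * ‖x‖ ^ 2 - (m * ‖x‖) ^ 2 := by linarith
      rw [h6]
      nlinarith
    have h7 : ((2 : ℝ) • x - (A x + A.symm x)) - m ^ 2 • x = 0 := by
      rw [← norm_eq_zero]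
      exact pow_eq_zero_iff two_ne_zero |>.1 (le_antisymm h3 (sq_nonneg _))
    rw [sub_smul, eq_comm, ← sub_eq_zero, ← h7]
    abel
  have hFA : ∀ x ∈ F, A x ∈ F := fun x hx => by
    rw [hF] at hx ⊢
    rw [A.symm_apply_apply, ← map_smul, ← hx, map_add, A.apply_symm_apply]
  have hFA' : ∀ x ∈ F, A.symm x ∈ F := fun x hx => by
    rw [hF] at hx ⊢
    rw [A.apply_symm_apply, ← map_smul, ← hx, map_add, A.symm_apply_apply]
  obtain ⟨c, hc0, hcle, hc⟩ := exists_norm_attained (toEnd A - 1) ⊤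
  have hcm : c = m := by
    have h1 : m ≤ c := ContinuousLinearMap.opNorm_le_bound _ hc0 fun x => hcle x trivial
    rcases hc with rfl | ⟨u, -, hu, rfl⟩
    · linarith
    · have := hle u
      rw [hu, mul_one] at this
      exact le_antisymm this h1
  obtain ⟨u, -, hu, huc⟩ := hc.resolve_left (by rw [hcm]; exact hmpos.ne')
  obtain ⟨m', hm'0, hm'le, hm'⟩ := exists_norm_attained (toEnd A - 1) Fᗮ
  have hlt : m' < m := by
    rcases hm' with rfl | ⟨v, hv, hv1, rfl⟩
    · exact hmpos
    · refine lt_of_le_of_ne (by simpa [hv1] using (toEnd A - 1).le_opNorm v) fun heq => ?_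
      have hvF : v ∈ F := hFmem v (by rw [hv1, mul_one]; exact heq)
      have : v = 0 := by
        have := hv v hvF
        rwa [inner_self_eq_zero] at this
      simp [this] at hv1
  refine ⟨F, u, m, m', hFmem u ?_, hu, hm'0, hlt, rfl, fun x hx => ⟨F.sub_mem (hFA x hx) hx, ?_⟩,
    fun x hx => ⟨Fᗮ.sub_mem ?_ hx, hm'le x hx⟩⟩
  · rw [hu, mul_one, ← hcm, ← huc]; rfl
  · rw [← sq_eq_sq₀ (norm_nonneg _) (by positivity), hsq, (hF x).1 hx, inner_smul_left,
      real_inner_self_eq_norm_sq]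
    simp only [RCLike.conj_to_real]
    ring
  · intro y hy
    rw [real_inner_comm, hflip, real_inner_comm]
    exact hx _ (hFA' y hy)

/-! ### Bieberbach's first theorem -/

-- Since `AB - BA = (A - 1)(B - 1) - (B - 1)(A - 1)`, the commutator of two rotations near the
-- identity is quadratically close to it.
open scoped commutatorElement in
theorem norm_linPart_commutator_sub_one_le {α β : Aff n} (hα : linPart n α ∈ orthGroup n)
    (hβ : linPart n β ∈ orthGroup n) :
    ‖toEnd (linPart n ⁅α, β⁆) - 1‖ ≤
      2 * ‖toEnd (linPart n α) - 1‖ * ‖toEnd (linPart n β) - 1‖ := by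
  set A := linPart n α
  set B := linPart n β
  have h1 : linPart n ⁅α, β⁆ = (A * B) * (B * A)⁻¹ := by
    rw [commutatorElement_def, map_mul, map_mul, map_mul, map_inv, map_inv, mul_inv_rev, mul_assoc,
      mul_assoc]
  rw [h1]
  refine (norm_toEnd_mul_inv_sub_one (mul_mem hβ hα)).trans ?_
  have h2 : toEnd (A * B) - toEnd (B * A) =
      (toEnd A - 1) * (toEnd B - 1) - (toEnd B - 1) * (toEnd A - 1) := by
    simp only [toEnd_mul, sub_mul, mul_sub, one_mul, mul_one]
    abel
  rw [h2]
  refine (norm_sub_le _ _).trans ?_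
  have h3 := norm_mul_le (toEnd A - 1) (toEnd B - 1)
  have h4 := norm_mul_le (toEnd B - 1) (toEnd A - 1)
  linarith

-- The commutator maps `β (α 0)` to `α (β 0)`. The first bracket is the main term; the other two are
-- errors, controlled by how little `β` rotates.
open scoped commutatorElement in
theorem commutator_apply_zero (α β : Aff n) :
    ⁅α, β⁆ 0 = (linPart n α (β 0) - β 0) - (toEnd (linPart n ⁅α, β⁆) - 1) (β 0)
      - linPart n α ((toEnd (linPart n β) - 1) (linPart n α⁻¹ (α 0))) := by
  have h : ⁅α, β⁆ (β (α 0)) = α (β 0) := by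
    rw [commutatorElement_def, aff_mul_apply, aff_mul_apply, aff_mul_apply, aff_inv_apply_self,
      aff_inv_apply_self]
  have hc : linPart n ⁅α, β⁆ (linPart n β (α 0)) =
      linPart n α (linPart n β (linPart n α⁻¹ (α 0))) := by
    rw [commutatorElement_def, linPart_mul_apply, linPart_mul_apply, linPart_mul_apply,
      linPart_inv_apply_self]
  rw [aff_apply, aff_apply β (α 0), aff_apply α (β 0), map_add, hc] at h
  rw [sub_apply, sub_apply, one_apply_eq_self, one_apply_eq_self, toEnd_apply, toEnd_apply,
    map_sub, linPart_apply_inv_self, ← sub_eq_iff_eq_add'.2 h.symm]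
  abel

/-- An element of a crystallographic group whose linear part is close to the identity is a
translation. -/
theorem IsProperCocompact.linPart_eq_one {π : Subgroup (Aff n)} (h : IsProperCocompact π)
    {α : Aff n} (hα : α ∈ π) (hle : ‖toEnd (linPart n α) - 1‖ ≤ 1 / 2) : linPart n α = 1 := by
  open scoped commutatorElement in
  by_contra hne
  obtain ⟨α, hα, ⟨hne, hle⟩, hmin⟩ := h.exists_min
    (P := fun γ => linPart n γ ≠ 1 ∧ ‖toEnd (linPart n γ) - 1‖ ≤ 1 / 2) ⟨α, hα, hne, hle⟩
  obtain ⟨F, u, m, m', huF, hu, hm'0, hm', hm, hF, hF'⟩ :=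
    exists_maximal_rotation_splitting (h.rigid α hα) hne
  rw [← hm] at hle
  -- Such a `β` rotates little and translates mainly within `F`, the directions that `α` moves most.
  -- The commutator with `α` keeps both features and, as `m ≤ 1 / 2`, has a shorter translation. So
  -- a shortest `β` is contradictory.
  let P : Aff n → Prop := fun β => ‖toEnd (linPart n β) - 1‖ ≤ (m - m') / 8 ∧
    ∃ x ∈ F, ∃ y ∈ Fᗮ, β 0 = x + y ∧ ‖y‖ < ‖x‖
  have hPex : ∃ β ∈ π, P β := by
    obtain ⟨β, hβ, t, ht, hrot, htr⟩ :=
      h.exists_almost_translation u (ε := (m - m') / 8) (by linarith)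
    obtain ⟨x, hx, y, hy, hxy⟩ := F.exists_add_mem_mem_orthogonal (β 0 - t • u)
    refine ⟨β, hβ, hrot, t • u + x, F.add_mem (F.smul_mem _ huF) hx, y, hy, ?_, ?_⟩
    · rw [add_assoc, ← hxy]; abel
    have hxy0 : inner ℝ x y = 0 := hy x hx
    have hpyth : ‖x + y‖ ^ 2 = ‖x‖ ^ 2 + ‖y‖ ^ 2 := by
      rw [norm_add_sq_real, hxy0]; ring
    have hb : ‖x + y‖ ≤ t / 8 := by
      rw [← hxy]
      refine htr.trans ?_
      nlinarith
    have hx8 : ‖x‖ ≤ t / 8 :=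
      (abs_le_of_sq_le_sq' (by nlinarith [sq_nonneg ‖y‖]) (norm_nonneg _)).2.trans hb
    have hy8 : ‖y‖ ≤ t / 8 :=
      (abs_le_of_sq_le_sq' (by nlinarith [sq_nonneg ‖x‖]) (norm_nonneg _)).2.trans hb
    have : t ≤ ‖t • u + x‖ + ‖x‖ := by
      have := norm_sub_le (t • u + x) x
      rw [add_sub_cancel_right, norm_smul, hu, mul_one, Real.norm_of_nonneg ht.le] at this
      exact this
    linarith
  obtain ⟨β, hβ, ⟨hrot, x, hx, y, hy, hxy, hlt⟩, hβmin⟩ := h.exists_min hPex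
  set b := ‖toEnd (linPart n β) - 1‖ with hbdef
  have hb0 : 0 ≤ b := norm_nonneg _
  have hxpos : 0 < ‖x‖ := (norm_nonneg _).trans_lt hlt
  have hnorm : ‖β 0‖ ≤ ‖x‖ + ‖y‖ := by rw [hxy]; exact norm_add_le _ _
  have hnormx : ‖x‖ ≤ ‖β 0‖ := by
    have hpyth : ‖x + y‖ ^ 2 = ‖x‖ ^ 2 + ‖y‖ ^ 2 := by
      rw [norm_add_sq_real, hy x hx]; ring
    rw [hxy]
    exact (abs_le_of_sq_le_sq' (by nlinarith [sq_nonneg ‖y‖]) (norm_nonneg _)).2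
  -- Minimality of `α` enters here: either `β` is a translation and `b = 0`, or `β` competes with
  -- `α`.
  have hab : b * ‖α 0‖ ≤ b * ‖β 0‖ := by
    by_cases hβ1 : linPart n β = 1
    · have : b = 0 := by rw [hbdef, hβ1, toEnd_one, sub_self, norm_zero]
      rw [this, zero_mul, zero_mul]
    · exact mul_le_mul_of_nonneg_left (hmin β hβ ⟨hβ1, by linarith⟩) hb0
  have hcomm : ‖toEnd (linPart n ⁅α, β⁆) - 1‖ ≤ 2 * m * b := by
    rw [hm]
    exact norm_linPart_commutator_sub_one_le (h.rigid α hα) (h.rigid β hβ)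
  have hcommb : 2 * m * b ≤ b := by nlinarith
  have hcmem : ⁅α, β⁆ ∈ π := by
    rw [commutatorElement_def]
    exact mul_mem (mul_mem (mul_mem hα hβ) (inv_mem hα)) (inv_mem hβ)
  obtain ⟨r, hr⟩ : ∃ r, r = - (toEnd (linPart n ⁅α, β⁆) - 1) (β 0)
      - linPart n α ((toEnd (linPart n β) - 1) (linPart n α⁻¹ (α 0))) := ⟨_, rfl⟩
  have hrle : ‖r‖ ≤ 2 * b * ‖β 0‖ := by
    rw [hr]
    refine (norm_sub_le _ _).trans ?_
    rw [norm_neg, h.rigid α hα]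
    have h1 := (toEnd (linPart n ⁅α, β⁆) - 1).le_opNorm (β 0)
    have h2 := (toEnd (linPart n β) - 1).le_opNorm (linPart n α⁻¹ (α 0))
    rw [h.rigid _ (inv_mem hα)] at h2
    have h3 := mul_le_mul_of_nonneg_right (hcomm.trans hcommb) (norm_nonneg (β 0))
    linarith
  have hrle' : ‖r‖ ≤ (m - m') / 4 * ‖β 0‖ :=
    hrle.trans (mul_le_mul_of_nonneg_right (by linarith) (norm_nonneg _))
  have hc0 : ⁅α, β⁆ 0 = (linPart n α (β 0) - β 0) + r := by
    rw [commutator_apply_zero, hr]; abel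
  obtain ⟨p, hp, q, hq, hpq⟩ := F.exists_add_mem_mem_orthogonal r
  have hpyth : ‖p + q‖ ^ 2 = ‖p‖ ^ 2 + ‖q‖ ^ 2 := by
    rw [norm_add_sq_real, hq p hp]; ring
  have hpr : ‖p‖ ≤ ‖r‖ := by
    rw [hpq]
    exact (abs_le_of_sq_le_sq' (by nlinarith [sq_nonneg ‖q‖]) (norm_nonneg _)).2
  have hqr : ‖q‖ ≤ ‖r‖ := by
    rw [hpq]
    exact (abs_le_of_sq_le_sq' (by nlinarith [sq_nonneg ‖p‖]) (norm_nonneg _)).2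
  have hr2 : ‖r‖ < (m - m') / 2 * ‖x‖ := by
    have : (m - m') / 4 * ‖β 0‖ < (m - m') / 4 * (2 * ‖x‖) :=
      mul_lt_mul_of_pos_left (by linarith) (by linarith)
    linarith
  -- The `F`-component has length at least `m * ‖x‖ - ‖r‖`, the other at most `m' * ‖x‖ + ‖r‖`; the
  -- bound `hr2` on `r` keeps the first larger.
  have hPc : P ⁅α, β⁆ := by
    refine ⟨hcomm.trans (hcommb.trans hrot), (linPart n α x - x) + p, F.add_mem (hF x hx).1 hp,
      (linPart n α y - y) + q, Fᗮ.add_mem (hF' y hy).1 hq, ?_, ?_⟩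
    · rw [hc0, hxy, hpq, map_add]; abel
    · have h1 := norm_add_le (linPart n α y - y) q
      have h2 := norm_sub_le ((linPart n α x - x) + p) p
      rw [add_sub_cancel_right, (hF x hx).2] at h2
      have h3 := (hF' y hy).2
      have h4 : m' * ‖y‖ ≤ m' * ‖x‖ := mul_le_mul_of_nonneg_left hlt.le hm'0
      linarith
  -- This contradicts `h5`, whose factor `m + (m - m') / 4` is at most `5 / 8`.
  have hfin := hβmin _ hcmem hPc
  have h5 : ‖⁅α, β⁆ 0‖ ≤ m * ‖β 0‖ + (m - m') / 4 * ‖β 0‖ := by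
    rw [hc0]
    refine (norm_add_le _ _).trans (add_le_add ?_ hrle')
    rw [hm]
    exact (toEnd (linPart n α) - 1).le_opNorm (β 0)
  have h6 : 0 < ‖β 0‖ := hxpos.trans_le hnormx
  nlinarith

/-- The vectors of the translations in `π`. -/
def translations (π : Subgroup (Aff n)) : AddSubgroup (E n) where
  carrier := {v | transl v ∈ π}
  add_mem' := by
    intro v w hv hw
    change transl (v + w) ∈ π
    rw [transl_add]
    exact mul_mem hv hw
  zero_mem' := by
    change transl 0 ∈ π
    rw [transl_zero]
    exact one_mem π
  neg_mem' := by
    intro v hv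
    change transl (-v) ∈ π
    rw [transl_neg]
    exact inv_mem hv

theorem mem_translations {π : Subgroup (Aff n)} {v : E n} :
    v ∈ translations π ↔ transl v ∈ π := Iff.rfl

/-- Otherwise take `u` orthogonal to all translations. An almost translation along `u` is a genuine
translation by `IsProperCocompact.linPart_eq_one`, hence orthogonal to `u`, yet it lies within `t *
‖u‖ / 2` of `t • u`. -/
theorem IsProperCocompact.span_translations {π : Subgroup (Aff n)} (h : IsProperCocompact π) :
    Submodule.span ℝ (translations π : Set (E n)) = ⊤ := by
  by_contra hne
  set V := Submodule.span ℝ (translations π : Set (E n))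
  obtain ⟨u, huV, hu0⟩ := Submodule.exists_mem_ne_zero_of_ne_bot
    (mt (Submodule.orthogonal_eq_bot_iff (K := V)).1 hne)
  obtain ⟨β, hβ, t, ht, hrot, htr⟩ := h.exists_almost_translation u
    (ε := min (1 / 2) (‖u‖ / 2)) (lt_min (by norm_num) (half_pos (norm_pos_iff.2 hu0)))
  have hβ1 := h.linPart_eq_one hβ (hrot.trans (min_le_left _ _))
  have hβV : β 0 ∈ V := Submodule.subset_span (by
    rw [SetLike.mem_coe, mem_translations, ← eq_transl hβ1]
    exact hβ)
  have h1 : ‖β 0 - t • u‖ ^ 2 = ‖β 0‖ ^ 2 + (t * ‖u‖) ^ 2 := by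
    rw [norm_sub_sq_real, inner_smul_right, huV _ hβV, norm_smul, Real.norm_of_nonneg ht.le]
    ring
  have h2 : ‖β 0 - t • u‖ ≤ ‖u‖ / 2 * t :=
    htr.trans (mul_le_mul_of_nonneg_right (min_le_right _ _) ht.le)
  have h3 := pow_le_pow_left₀ (norm_nonneg _) h2 2
  have h4 : 0 < t * ‖u‖ := mul_pos ht (norm_pos_iff.2 hu0)
  nlinarith [sq_nonneg ‖β 0‖]

/-- The orthogonal group is bounded, and two holonomy elements closer than `1 / 2` coincide because
their quotient comes from a translation. -/
theorem IsProperCocompact.finite_holonomy {π : Subgroup (Aff n)} (h : IsProperCocompact π) :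
    (holonomy π : Set (GLin n)).Finite := by
  by_contra hinf
  have hinf' : (toEnd '' (holonomy π : Set (GLin n))).Infinite :=
    Set.Infinite.image toEnd_injective.injOn hinf
  have hsub : toEnd '' (holonomy π : Set (GLin n)) ⊆ closedBall (0 : E n →L[ℝ] E n) 1 := by
    rintro _ ⟨_, ⟨γ, hγ, rfl⟩, rfl⟩
    simpa using norm_toEnd_le_one (h.rigid γ hγ)
  obtain ⟨_, ⟨_, ⟨γ, hγ, rfl⟩, rfl⟩, _, ⟨_, ⟨δ, hδ, rfl⟩, rfl⟩, hne, hlt⟩ :=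
    exists_ne_dist_lt_of_infinite (isCompact_closedBall _ _).totallyBounded hsub hinf'
      (ε := 1 / 2) (by norm_num)
  refine hne (congrArg toEnd ?_)
  rw [dist_comm, dist_eq_norm] at hlt
  have := h.linPart_eq_one (mul_mem (inv_mem hγ) hδ) (by
    rw [map_mul, map_inv]
    exact (norm_toEnd_inv_mul_sub_one (h.rigid γ hγ)).trans hlt.le)
  rw [map_mul, map_inv, inv_mul_eq_one] at this
  exact this

theorem IsProperCocompact.exists_translations_sep {π : Subgroup (Aff n)}
    (h : IsProperCocompact π) :
    ∃ ε > 0, ∀ v ∈ translations π, ‖v‖ < ε → v = 0 := by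
  by_cases hex : ∃ γ ∈ π, linPart n γ = 1 ∧ γ 0 ≠ 0
  · obtain ⟨γ, hγ, ⟨-, hγ0⟩, hmin⟩ := h.exists_min hex
    refine ⟨‖γ 0‖, norm_pos_iff.2 hγ0, fun v hv hlt => ?_⟩
    by_contra hv0
    have := hmin (transl v) hv ⟨linPart_transl v, by rwa [transl_apply, zero_add]⟩
    rw [transl_apply, zero_add] at this
    exact this.not_gt hlt
  · refine ⟨1, one_pos, fun v hv _ => ?_⟩
    by_contra hv0
    exact hex ⟨transl v, hv, linPart_transl v, by rwa [transl_apply, zero_add]⟩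

/-! ### Discreteness of the linear part of the normalizer -/

/-- Conjugation makes `N_π` preserve the lattice of translations. If `C` and `D` are close, `C v - D
v` is a lattice vector too short to be nonzero, for each `v` in a finite spanning set of lattice
vectors. -/
theorem IsProperCocompact.discreteTopology_linNormalizer {π : Subgroup (Aff n)}
    (h : IsProperCocompact π) :
    DiscreteTopology (toEnd '' (linNormalizer π : Set (GLin n))) := by
  obtain ⟨ε, hε, hsep⟩ := h.exists_translations_sep
  have hpres : ∀ C ∈ linNormalizer π, ∀ v ∈ translations π, C v ∈ translations π := by
    rintro _ ⟨c, hc, rfl⟩ v hv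
    rw [mem_translations, ← conj_transl]
    exact (Subgroup.mem_set_normalizer_iff.1 hc (transl v)).1 hv
  obtain ⟨s, hs, hspan, hli⟩ := exists_linearIndependent ℝ (translations π : Set (E n))
  rw [h.span_translations] at hspan
  have hfin : s.Finite := hli.setFinite
  obtain ⟨M, hM⟩ := hfin.isBounded.exists_norm_le
  have hM0 : 0 < |M| + 1 := by positivity
  refine DiscreteTopology.of_forall_le_dist (div_pos hε hM0) ?_
  rintro ⟨_, C, hC, rfl⟩ ⟨_, D, hD, rfl⟩ hne
  by_contra! hlt
  refine hne (Subtype.ext (congrArg toEnd ?_))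
  rw [Subtype.dist_eq, dist_eq_norm, lt_div_iff₀ hM0] at hlt
  apply LinearEquiv.toLinearMap_injective
  refine LinearMap.ext_on hspan fun v hv => ?_
  rw [← sub_eq_zero]
  refine hsep _ (sub_mem (hpres C hC v (hs hv)) (hpres D hD v (hs hv))) ?_
  refine ((toEnd C - toEnd D).le_opNorm v).trans_lt (lt_of_le_of_lt ?_ hlt)
  exact mul_le_mul_of_nonneg_left (by linarith [hM v hv, le_abs_self M]) (norm_nonneg _)

/-! ### Bieberbach's second theorem -/

/-- An additive map on a full lattice extends to a linear map. -/
theorem exists_linearMap_extending (T : AddSubgroup (E n))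
    (hspan : Submodule.span ℝ (T : Set (E n)) = ⊤) {ε : ℝ} (hε : 0 < ε)
    (hsep : ∀ v ∈ T, ‖v‖ < ε → v = 0) (θ : T →+ E n) :
    ∃ A : E n →ₗ[ℝ] E n, ∀ v : T, A v = θ v := by
  let L : Submodule ℤ (E n) := AddSubgroup.toIntSubmodule T
  have hdisc : DiscreteTopology L := by
    refine DiscreteTopology.of_forall_le_dist hε fun v w hne => ?_
    by_contra! hlt
    rw [Subtype.dist_eq, dist_eq_norm] at hlt
    exact hne (Subtype.ext (sub_eq_zero.1 (hsep _ (sub_mem v.2 w.2) hlt)))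
  have hlat : IsZLattice ℝ L := ⟨hspan⟩
  have : Module.Free ℤ L := ZLattice.module_free ℝ L
  let b := Module.Free.chooseBasis ℤ L
  let A : E n →ₗ[ℝ] E n := (b.ofZLatticeBasis ℝ L).constr ℝ fun i => θ (b i)
  refine ⟨A, fun v => ?_⟩
  have heq : (A.restrictScalars ℤ) ∘ₗ L.subtype = (AddMonoidHom.toIntLinearMap θ : L →ₗ[ℤ] E n) := by
    refine b.ext fun i => ?_
    have : A (b.ofZLatticeBasis ℝ L i) = θ (b i) := Module.Basis.constr_basis _ _ _ _
    rw [Module.Basis.ofZLatticeBasis_apply] at this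
    exact this
  exact LinearMap.congr_fun heq v

/-- A homomorphism between crystallographic groups whose image is crystallographic is conjugation
by an affine transformation. -/
theorem IsProperCocompact.exists_affine_conj {π : Subgroup (Aff n)} (h : IsProperCocompact π)
    (ρ : π →* Aff n) (hρ : IsProperCocompact ρ.range) :
    ∃ a : Aff n, ∀ γ : π, ρ γ = a * γ * a⁻¹ := by
  -- The kernel consists of the translations in `π` whose images are translations too. Both holonomy
  -- groups are finite, so it has finite index.
  let lin : π →* GLin n × GLin n :=
    ((linPart n).comp π.subtype).prod ((linPart n).comp ρ)
  have hfin : Finite lin.range := by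
    refine Set.Finite.subset (h.finite_holonomy.prod hρ.finite_holonomy) ?_
    rintro _ ⟨γ, rfl⟩
    exact ⟨⟨γ, γ.2, rfl⟩, ⟨ρ γ, ⟨γ, rfl⟩, rfl⟩⟩
  have hindex : lin.ker.FiniteIndex := inferInstance
  have hker : ∀ γ : π, γ ∈ lin.ker ↔ linPart n γ = 1 ∧ linPart n (ρ γ) = 1 := fun γ => by
    rw [MonoidHom.mem_ker, Prod.ext_iff]; rfl
  have hidx0 : (lin.ker.index : ℝ) ≠ 0 := by exact_mod_cast hindex.index_ne_zero
  have hpow : ∀ γ : π, γ ^ lin.ker.index ∈ lin.ker := fun γ => Subgroup.pow_index_mem _ γ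
  let T : AddSubgroup (E n) :=
    { carrier := {v | ∃ hv : transl v ∈ π, linPart n (ρ ⟨transl v, hv⟩) = 1}
      add_mem' := by
        rintro v w ⟨hv, hv'⟩ ⟨hw, hw'⟩
        have hmem : transl (v + w) ∈ π := by rw [transl_add]; exact mul_mem hv hw
        refine ⟨hmem, ?_⟩
        have : (⟨transl (v + w), hmem⟩ : π) = ⟨transl v, hv⟩ * ⟨transl w, hw⟩ :=
          Subtype.ext (transl_add v w)
        rw [this, map_mul, map_mul, hv', hw', one_mul]
      zero_mem' := by
        have hmem : transl (0 : E n) ∈ π := by rw [transl_zero]; exact one_mem π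
        refine ⟨hmem, ?_⟩
        have : (⟨transl (0 : E n), hmem⟩ : π) = 1 := Subtype.ext transl_zero
        rw [this, map_one, map_one]
      neg_mem' := by
        rintro v ⟨hv, hv'⟩
        have hmem : transl (-v) ∈ π := by rw [transl_neg]; exact inv_mem hv
        refine ⟨hmem, ?_⟩
        have : (⟨transl (-v), hmem⟩ : π) = ⟨transl v, hv⟩⁻¹ := Subtype.ext (transl_neg v)
        rw [this, map_inv, map_inv, hv', inv_one] }
  let τ : T → π := fun v => ⟨transl (v : E n), v.2.1⟩
  have hτ : ∀ v : T, linPart n (ρ (τ v)) = 1 := fun v => v.2.2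
  let θ : T →+ E n :=
    { toFun := fun v => ρ (τ v) 0
      map_zero' := by
        have : τ 0 = 1 := Subtype.ext transl_zero
        rw [this, map_one]; rfl
      map_add' := fun v w => by
        have : τ (v + w) = τ v * τ w := Subtype.ext (transl_add _ _)
        rw [this, map_mul, aff_mul_apply, aff_apply (ρ (τ v)), hτ]
        exact add_comm _ _ }
  have hθ : ∀ v : T, ρ (τ v) = transl (θ v) := fun v => eq_transl (hτ v)
  -- elements of the kernel are translations by vectors in `T`
  have hkerT : ∀ γ ∈ lin.ker, ∃ v : T, γ = τ v := fun γ hγ => by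
    obtain ⟨h1, h2⟩ := (hker γ).1 hγ
    have heq := eq_transl h1
    have hmem : transl ((γ : Aff n) 0) ∈ π := by rw [← heq]; exact γ.2
    have hsub : (⟨transl ((γ : Aff n) 0), hmem⟩ : π) = γ := Subtype.ext heq.symm
    exact ⟨⟨(γ : Aff n) 0, hmem, by rw [hsub]; exact h2⟩, hsub.symm⟩
  -- Raising a translation to the index of the kernel lands in the kernel, so `T` contains a nonzero
  -- multiple of each translation vector.
  have hTspan : Submodule.span ℝ (T : Set (E n)) = ⊤ := by
    rw [eq_top_iff, ← h.span_translations, Submodule.span_le]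
    intro v hv
    obtain ⟨w, hw⟩ := hkerT _ (hpow ⟨transl v, hv⟩)
    have h1 : (w : E n) = lin.ker.index • v := by
      have h2 := congrArg (fun γ : π => (γ : Aff n) 0) hw
      change (transl v ^ lin.ker.index) 0 = transl (w : E n) 0 at h2
      rw [← transl_nsmul, transl_apply, transl_apply, zero_add, zero_add] at h2
      exact h2.symm
    have h3 : v = (lin.ker.index : ℝ)⁻¹ • (w : E n) := by
      rw [h1, ← Nat.cast_smul_eq_nsmul ℝ, smul_smul, inv_mul_cancel₀ hidx0, one_smul]
    rw [h3]
    exact Submodule.smul_mem _ _ (Submodule.subset_span w.2)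
  obtain ⟨ε, hε, hsep⟩ := h.exists_translations_sep
  obtain ⟨A, hA⟩ := exists_linearMap_extending T hTspan hε (fun v hv => hsep v hv.1) θ
  -- The same power argument in the image: its translation vectors span, and a multiple of each is a
  -- value of `θ`. Invertibility of `A` follows by dimension.
  have hsurj : Function.Surjective A := by
    rw [← LinearMap.range_eq_top, eq_top_iff, ← hρ.span_translations, Submodule.span_le]
    rintro v ⟨γ, hγ⟩
    obtain ⟨w, hw⟩ := hkerT _ (hpow γ)
    have h1 : lin.ker.index • v = θ w := by
      have h2 := congrArg (fun γ : π => ρ γ 0) hw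
      simp only [map_pow, hγ, hθ] at h2
      rw [← transl_nsmul, transl_apply, transl_apply, zero_add, zero_add] at h2
      exact h2
    refine ⟨(lin.ker.index : ℝ)⁻¹ • (w : E n), ?_⟩
    rw [map_smul, hA, ← h1, ← Nat.cast_smul_eq_nsmul ℝ, smul_smul, inv_mul_cancel₀ hidx0, one_smul]
  have hlin : ∀ (γ : π) (x : E n), A (linPart n γ x) = linPart n (ρ γ) (A x) := fun γ x => by
    have heq : A ∘ₗ (linPart n (γ : Aff n) : E n →ₗ[ℝ] E n) =
        (linPart n (ρ γ) : E n →ₗ[ℝ] E n) ∘ₗ A := by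
      refine LinearMap.ext_on hTspan fun v hv => ?_
      have hk : γ * τ ⟨v, hv⟩ * γ⁻¹ ∈ lin.ker :=
        (MonoidHom.normal_ker lin).conj_mem _ ((hker _).2 ⟨linPart_transl v, hτ _⟩) γ
      obtain ⟨w, hw⟩ := hkerT _ hk
      have h1 : linPart n γ v = w := by
        have h2 := congrArg (fun γ : π => (γ : Aff n) 0) hw
        change ((γ : Aff n) * transl v * (γ : Aff n)⁻¹) 0 = transl (w : E n) 0 at h2
        rwa [conj_transl, transl_apply, transl_apply, zero_add, zero_add] at h2
      have h2 : linPart n (ρ γ) (θ ⟨v, hv⟩) = θ w := by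
        have h2 := congrArg (fun γ : π => ρ γ 0) hw
        simp only [map_mul, map_inv, hθ] at h2
        rwa [conj_transl, transl_apply, transl_apply, zero_add, zero_add] at h2
      change A (linPart n γ v) = linPart n (ρ γ) (A v)
      rw [h1, hA, ← h2, ← hA]
    exact LinearMap.congr_fun heq x
  let A' : GLin n := LinearEquiv.ofBijective A ⟨LinearMap.injective_iff_surjective.2 hsurj, hsurj⟩
  have hA' : ∀ x, A' x = A x := fun x => rfl
  have : Fintype (π ⧸ lin.ker) := Fintype.ofFinite _
  -- `π` acts on affine maps by `f ↦ ρ γ ∘ f ∘ γ⁻¹`. The kernel fixes `A`, so its orbit is finite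
  -- and consists of maps with linear part `A`; `w` records their values at `0`. The average over
  -- the orbit is the equivariant map `x ↦ A x + c`.
  let w : π ⧸ lin.ker → E n := Quotient.lift (fun γ : π => ρ γ (A ((γ : Aff n)⁻¹ 0))) (by
    intro γ δ hγδ
    obtain ⟨v, hv⟩ := hkerT _ (QuotientGroup.leftRel_apply.1 hγδ)
    obtain rfl : δ = γ * τ v := by rw [← hv, mul_inv_cancel_left]
    change ρ γ (A ((γ : Aff n)⁻¹ 0)) = ρ (γ * τ v) (A (((γ : Aff n) * transl (v : E n))⁻¹ 0))
    rw [map_mul, aff_mul_apply, hθ, transl_apply, mul_inv_rev, aff_mul_apply, ← transl_neg,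
      transl_apply, map_add A, map_neg, hA, neg_add_cancel_right])
  have hw : ∀ (δ : π) (q : π ⧸ lin.ker),
      linPart n (ρ δ) (w q) + ρ δ 0 = w (δ • q) + A ((δ : Aff n) 0) := by
    rintro δ ⟨γ⟩
    change linPart n (ρ δ) (ρ γ (A ((γ : Aff n)⁻¹ 0))) + ρ δ 0 =
      ρ (δ * γ) (A (((δ : Aff n) * γ)⁻¹ 0)) + A ((δ : Aff n) 0)
    have h1 : A ((γ : Aff n)⁻¹ 0) =
        A (((δ : Aff n) * γ)⁻¹ 0) + A (linPart n ((δ * γ : π)⁻¹ : π) ((δ : Aff n) 0)) := by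
      have h2 : (γ : Aff n)⁻¹ 0 = ((δ : Aff n) * γ)⁻¹ ((δ : Aff n) 0) := by
        rw [mul_inv_rev, aff_mul_apply, aff_inv_apply_self]
      rw [h2, aff_apply, map_add, add_comm]; rfl
    rw [← aff_apply, ← aff_mul_apply, ← map_mul, h1, aff_apply_add, hlin, ← linPart_mul_apply,
      ← map_mul, mul_inv_cancel, map_one, map_one]
    rfl
  let N : ℝ := Fintype.card (π ⧸ lin.ker)
  have hN : N ≠ 0 := by
    have : Nonempty (π ⧸ lin.ker) := ⟨(1 : π)⟩
    exact Nat.cast_ne_zero.2 Fintype.card_ne_zero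
  let c : E n := N⁻¹ • ∑ q, w q
  have hc : ∀ δ : π, ρ δ c = c + A ((δ : Aff n) 0) := fun δ => by
    have h1 : ∑ q, (linPart n (ρ δ) (w q) + ρ δ 0) = ∑ q, (w (δ • q) + A ((δ : Aff n) 0)) :=
      Finset.sum_congr rfl fun q _ => hw δ q
    rw [Finset.sum_add_distrib, Finset.sum_add_distrib, ← map_sum,
      (MulAction.bijective δ).sum_comp w, Finset.sum_const, Finset.sum_const, Finset.card_univ,
      ← Nat.cast_smul_eq_nsmul ℝ, ← Nat.cast_smul_eq_nsmul ℝ] at h1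
    have h2 := congrArg (fun x => N⁻¹ • x) h1
    simp only [smul_add, smul_smul] at h2
    rw [inv_mul_cancel₀ hN, one_smul, one_smul, ← map_smul] at h2
    rw [aff_apply]
    exact h2
  refine ⟨mkAff A' c, fun γ => ?_⟩
  rw [eq_mul_inv_iff_mul_eq]
  ext1 x
  rw [aff_mul_apply, aff_mul_apply, mkAff_apply, mkAff_apply, hA', hA', aff_apply (γ : Aff n) x,
    map_add A, hlin, add_comm (A x), aff_apply_add, hc]
  abel

/-! ### Local isometries -/

/-- A field of bilinear forms on `ℝⁿ`. -/
abbrev Form (n : ℕ) : Type := E n → E n →L[ℝ] E n →L[ℝ] ℝ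

/-- The Euclidean metric. -/
def euclForm (n : ℕ) : Form n := fun _ => innerSL ℝ

theorem euclForm_apply (x u v : E n) : euclForm n x u v = inner ℝ u v := rfl

/-- `f` is smooth at `z` and its derivative at `z` pulls `g'` back to `g`. -/
def IsometricAt (g g' : Form n) (f : E n → E n) (z : E n) : Prop :=
  ContDiffAt ℝ ∞ f z ∧ ∀ u v, g' (f z) (fderiv ℝ f z u) (fderiv ℝ f z v) = g z u v

theorem IsometricAt.congr {g g' : Form n} {f h : E n → E n} {z : E n} (hf : IsometricAt g g' f z)
    (hfh : f =ᶠ[𝓝 z] h) : IsometricAt g g' h z := by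
  refine ⟨hf.1.congr_of_eventuallyEq hfh.symm, fun u v => ?_⟩
  rw [← hfh.fderiv_eq, ← hfh.eq_of_nhds, hf.2]

theorem IsometricAt.differentiableAt {g g' : Form n} {f : E n → E n} {z : E n}
    (hf : IsometricAt g g' f z) : DifferentiableAt ℝ f z := hf.1.differentiableAt (by simp)

theorem IsometricAt.continuousAt {g g' : Form n} {f : E n → E n} {z : E n}
    (hf : IsometricAt g g' f z) : ContinuousAt f z := hf.1.continuousAt

theorem IsometricAt.comp {g g' g'' : Form n} {f h : E n → E n} {z : E n}
    (hh : IsometricAt g' g'' h (f z)) (hf : IsometricAt g g' f z) :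
    IsometricAt g g'' (h ∘ f) z := by
  refine ⟨hh.1.comp z hf.1, fun u v => ?_⟩
  rw [fderiv_comp z hh.differentiableAt hf.differentiableAt]
  simp only [ContinuousLinearMap.comp_apply, Function.comp_apply]
  rw [hh.2, hf.2]

theorem isometricAt_id (g : Form n) (z : E n) : IsometricAt g g id z :=
  ⟨contDiffAt_id, fun u v => by rw [fderiv_id]; rfl⟩

theorem isometricAt_aff {g g' : Form n} (γ : Aff n) {z : E n}
    (h : ∀ u v, g' (γ z) (linPart n γ u) (linPart n γ v) = g z u v) :
    IsometricAt g g' γ z :=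
  ⟨(contDiff_aff γ).contDiffAt, fun u v => by rw [fderiv_aff]; exact h u v⟩

theorem isometricAt_rigid {γ : Aff n} (hγ : linPart n γ ∈ orthGroup n) (z : E n) :
    IsometricAt (euclForm n) (euclForm n) γ z :=
  isometricAt_aff γ fun u v => (orthIsometry hγ).inner_map_map u v

theorem IsometricAt.symm {g g' : Form n} {φ : OpenPartialHomeomorph (E n) (E n)}
    (hφ : ∀ z ∈ φ.source, IsometricAt g g' φ z) (hs : ContDiffOn ℝ ∞ φ.symm φ.target)
    {w : E n} (hw : w ∈ φ.target) : IsometricAt g' g φ.symm w := by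
  have hz := φ.map_target hw
  have d2 : ContDiffAt ℝ ∞ φ.symm w := hs.contDiffAt (φ.open_target.mem_nhds hw)
  refine ⟨d2, fun u v => ?_⟩
  have hid : (fderiv ℝ φ (φ.symm w)).comp (fderiv ℝ φ.symm w) = ContinuousLinearMap.id ℝ _ := by
    rw [← fderiv_comp w (hφ _ hz).differentiableAt (d2.differentiableAt (by simp)),
      ← fderiv_id (𝕜 := ℝ) (x := w)]
    apply Filter.EventuallyEq.fderiv_eq
    filter_upwards [φ.open_target.mem_nhds hw] with t ht using φ.right_inv ht
  have hid' : ∀ u, fderiv ℝ φ (φ.symm w) (fderiv ℝ φ.symm w u) = u := fun u =>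
    DFunLike.congr_fun hid u
  rw [← (hφ _ hz).2, hid', hid', φ.right_inv hw]

/-- A chart of `ℝⁿ` which is isometric from the metric `g` to the Euclidean metric. -/
structure IsChart (g : Form n) (φ : OpenPartialHomeomorph (E n) (E n)) : Prop where
  isometricAt : ∀ z ∈ φ.source, IsometricAt g (euclForm n) φ z
  isometricAt_symm : ∀ w ∈ φ.target, IsometricAt (euclForm n) g φ.symm w

/-- A metric which is locally isometric to the Euclidean metric. -/
def IsFlatForm (g : Form n) : Prop :=
  ∀ x, ∃ φ : OpenPartialHomeomorph (E n) (E n), x ∈ φ.source ∧ IsChart g φ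

theorem isFlatForm_euclForm : IsFlatForm (euclForm n) := fun _ =>
  ⟨OpenPartialHomeomorph.refl _, trivial, fun z _ => isometricAt_id _ z, fun z _ => isometricAt_id _ z⟩

theorem FlatMetric.isFlatForm {π : Subgroup (Aff n)} (g : FlatMetric π) : IsFlatForm g.form := by
  intro x
  obtain ⟨φ, hx, h1, h2, h3⟩ := g.flat x
  have h4 : ∀ z ∈ φ.source, IsometricAt g.form (euclForm n) φ z := fun z hz =>
    ⟨h1.contDiffAt (φ.open_source.mem_nhds hz), h3 z hz⟩
  exact ⟨φ, hx, h4, fun w hw => IsometricAt.symm h4 h2 hw⟩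

/-- A local isometry of Euclidean space has vanishing second derivative. -/
theorem fderiv_fderiv_eq_zero_of_isometricAt {f : E n → E n} {z : E n}
    (hf : ∀ᶠ w in 𝓝 z, IsometricAt (euclForm n) (euclForm n) f w) :
    fderiv ℝ (fderiv ℝ f) z = 0 := by
  have hz := hf.self_of_nhds
  have hd : HasFDerivAt (fderiv ℝ f) (fderiv ℝ (fderiv ℝ f) z) z :=
    ((hz.1.fderiv_right (m := 1) (by norm_cast)).differentiableAt (by simp)).hasFDerivAt
  have hsymm : ∀ u v, fderiv ℝ (fderiv ℝ f) z u v = fderiv ℝ (fderiv ℝ f) z v u := fun u v =>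
    (hz.1.isSymmSndFDerivAt (by simpa using (by norm_cast : (2 : WithTop ℕ∞) ≤ ∞))) u v
  -- Differentiate the identity `⟨Df v, Df w⟩ = ⟨v, w⟩` in the direction `u`.
  have hskew : ∀ u v w, inner ℝ (fderiv ℝ (fderiv ℝ f) z u v) (fderiv ℝ f z w) =
      - inner ℝ (fderiv ℝ (fderiv ℝ f) z u w) (fderiv ℝ f z v) := fun u v w => by
    have h1 : HasFDerivAt (fun y => inner ℝ (fderiv ℝ f y v) (fderiv ℝ f y w)) _ z :=
      (hd.clm_apply (hasFDerivAt_const v z)).inner ℝ (hd.clm_apply (hasFDerivAt_const w z))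
    have h2 : HasFDerivAt (fun y => inner ℝ (fderiv ℝ f y v) (fderiv ℝ f y w))
        (0 : E n →L[ℝ] ℝ) z := by
      refine (hasFDerivAt_const (inner ℝ v w : ℝ) z).congr_of_eventuallyEq ?_
      filter_upwards [hf] with y hy using hy.2 v w
    have h3 := DFunLike.congr_fun (h1.unique h2) u
    simp at h3
    rw [real_inner_comm _ (fderiv ℝ f z v)] at h3
    linarith
  -- A trilinear form symmetric in the first two arguments and skew in the last two vanishes, as in
  -- the uniqueness of the Levi-Civita connection.
  have hzero : ∀ u v w, inner ℝ (fderiv ℝ (fderiv ℝ f) z u v) (fderiv ℝ f z w) = 0 :=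
    fun u v w => by
      have e1 := hskew u v w
      have e2 := hskew w u v
      have e3 := hskew v w u
      rw [hsymm w u] at e2
      rw [hsymm w v] at e2
      rw [hsymm v u] at e3
      linarith
  have hinj : Function.Injective (fderiv ℝ f z : E n →ₗ[ℝ] E n) := by
    rw [← LinearMap.ker_eq_bot, LinearMap.ker_eq_bot']
    intro u hu
    have := hz.2 u u
    rw [euclForm_apply, euclForm_apply] at this
    have hu' : fderiv ℝ f z u = 0 := hu
    rwa [hu', inner_zero_left, eq_comm, inner_self_eq_zero] at this
  ext1 u
  ext1 v
  obtain ⟨w, hw⟩ := LinearMap.injective_iff_surjective.1 hinj (fderiv ℝ (fderiv ℝ f) z u v)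
  have := hzero u v w
  have hw' : fderiv ℝ f z w = fderiv ℝ (fderiv ℝ f) z u v := hw
  rwa [hw', inner_self_eq_zero] at this

/-- A local isometry of Euclidean space on a connected open set is the restriction of a rigid
motion. -/
theorem exists_rigid_eqOn {U : Set (E n)} (hU : IsOpen U) (hc : IsPreconnected U)
    (hne : U.Nonempty) {f : E n → E n}
    (hf : ∀ z ∈ U, IsometricAt (euclForm n) (euclForm n) f z) :
    ∃ T : Aff n, linPart n T ∈ orthGroup n ∧ EqOn f T U := by
  obtain ⟨x, hx⟩ := hne
  have hconst : ∀ z ∈ U, fderiv ℝ f z = fderiv ℝ f x := fun z hz => by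
    refine hU.is_const_of_fderiv_eq_zero (𝕜 := ℝ) hc ?_ ?_ hz hx
    · exact fun w hw => (((hf w hw).1.fderiv_right (m := 1) (by norm_cast)).differentiableAt
        (by simp)).differentiableWithinAt
    · exact fun w hw => fderiv_fderiv_eq_zero_of_isometricAt
        (by filter_upwards [hU.mem_nhds hw] with y hy using hf y hy)
  have hnorm : ∀ u, ‖fderiv ℝ f x u‖ = ‖u‖ := fun u => by
    have := (hf x hx).2 u u
    rw [euclForm_apply, euclForm_apply, real_inner_self_eq_norm_sq,
      real_inner_self_eq_norm_sq] at this
    exact (sq_eq_sq₀ (norm_nonneg _) (norm_nonneg _)).1 this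
  have hinj : Function.Injective (fderiv ℝ f x : E n →ₗ[ℝ] E n) := by
    rw [← LinearMap.ker_eq_bot, LinearMap.ker_eq_bot']
    intro u hu
    rw [← norm_eq_zero, ← hnorm u]
    exact norm_eq_zero.2 hu
  let A : GLin n := LinearEquiv.ofInjectiveEndo _ hinj
  have hA : ∀ u, A u = fderiv ℝ f x u := fun u => rfl
  refine ⟨mkAff A (f x - A x), ?_, ?_⟩
  · rw [linPart_mkAff]
    exact hnorm
  · refine hU.eqOn_of_fderiv_eq (𝕜 := ℝ) hc
      (fun z hz => (hf z hz).differentiableAt.differentiableWithinAt)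
      ((contDiff_aff _).differentiable (by simp)).differentiableOn (fun z hz => ?_) hx ?_
    · rw [fderiv_aff, linPart_mkAff, hconst z hz]
      rfl
    · rw [mkAff_apply]; abel

theorem aff_eq_of_eventuallyEq {S T : Aff n} {x : E n} (h : S =ᶠ[𝓝 x] T) : S = T := by
  obtain ⟨U, hU, hUo, hx⟩ := _root_.mem_nhds_iff.1 h
  exact AffineEquiv.ext_on (hUo.affineSpan_eq_top ⟨x, hx⟩) _ _ hU

theorem exists_rigid_eventuallyEq {x : E n} {f : E n → E n}
    (hf : ∀ᶠ z in 𝓝 x, IsometricAt (euclForm n) (euclForm n) f z) :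
    ∃ T : Aff n, linPart n T ∈ orthGroup n ∧ f =ᶠ[𝓝 x] T := by
  obtain ⟨r, hr, hball⟩ := Metric.eventually_nhds_iff_ball.1 hf
  obtain ⟨T, hT, heq⟩ := exists_rigid_eqOn isOpen_ball (convex_ball x r).isPreconnected
    ⟨x, mem_ball_self hr⟩ hball
  exact ⟨T, hT, eventually_of_mem (ball_mem_nhds x hr) heq⟩

/-- A local isometry to Euclidean space is, near a point, a chart followed by a rigid motion. -/
theorem IsChart.exists_rigid_eventuallyEq_comp {g : Form n}
    {φ : OpenPartialHomeomorph (E n) (E n)} (hφ : IsChart g φ) {x : E n} (hx : x ∈ φ.source)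
    {f : E n → E n} (hf : ∀ᶠ z in 𝓝 x, IsometricAt g (euclForm n) f z) :
    ∃ T : Aff n, linPart n T ∈ orthGroup n ∧ f =ᶠ[𝓝 x] T ∘ φ := by
  have ht := φ.map_source hx
  have hsymm : Tendsto φ.symm (𝓝 (φ x)) (𝓝 x) := by
    have := φ.continuousAt_symm ht
    rwa [ContinuousAt, φ.left_inv hx] at this
  obtain ⟨T, hT, heq⟩ := exists_rigid_eventuallyEq (x := φ x) (f := f ∘ φ.symm) (by
    filter_upwards [hsymm.eventually hf, φ.open_target.mem_nhds ht] with w h1 h2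
    exact h1.comp (hφ.isometricAt_symm w h2))
  refine ⟨T, hT, ?_⟩
  filter_upwards [(φ.continuousAt hx).eventually heq, φ.open_source.mem_nhds hx] with z h1 h2
  simp only [Function.comp_apply, φ.left_inv h2] at h1
  exact h1

/-- Local isometries between flat metrics that agree near a point agree on connected sets. -/
theorem eqOn_of_isometricAt {g g' : Form n} (hg : IsFlatForm g) (hg' : IsFlatForm g')
    {U : Set (E n)} (hU : IsOpen U) (hc : IsPreconnected U) {f h : E n → E n}
    (hf : ∀ z ∈ U, IsometricAt g g' f z) (hh : ∀ z ∈ U, IsometricAt g g' h z)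
    {x : E n} (hx : x ∈ U) (hfh : f =ᶠ[𝓝 x] h) : EqOn f h U := by
  -- The set of points where the germs agree is open. At a limit point `z`, charts turn both maps
  -- into rigid motions `S` and `T`; these agree near some point close to `z`, so they are equal.
  suffices U ⊆ {z | f =ᶠ[𝓝 z] h} from fun z hz => (this hz).eq_of_nhds
  refine hc.subset_of_closure_inter_subset
    (isOpen_iff_eventually.2 fun z hz => eventually_eventually_nhds.2 hz) ⟨x, hx, hfh⟩ ?_
  rintro z ⟨hzc, hzU⟩
  have hfreq : ∃ᶠ w in 𝓝 z, f =ᶠ[𝓝 w] h := mem_closure_iff_frequently.1 hzc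
  have hfz := (hf z hzU).continuousAt
  have hhz := (hh z hzU).continuousAt
  have hval : f z = h z :=
    tendsto_nhds_unique_of_frequently_eq hfz hhz (hfreq.mono fun w hw => hw.eq_of_nhds)
  obtain ⟨φ, hzφ, hφ⟩ := hg z
  obtain ⟨ψ, hzψ, hψ⟩ := hg' (f z)
  have hUz : ∀ᶠ w in 𝓝 z, w ∈ U := hU.mem_nhds hzU
  have hfψ : ∀ᶠ w in 𝓝 z, f w ∈ ψ.source := hfz (ψ.open_source.mem_nhds hzψ)
  have hhψ : ∀ᶠ w in 𝓝 z, h w ∈ ψ.source := hhz (ψ.open_source.mem_nhds (hval ▸ hzψ))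
  obtain ⟨S, -, hS⟩ := hφ.exists_rigid_eventuallyEq_comp hzφ (f := ψ ∘ f) (by
    filter_upwards [hUz, hfψ] with w h1 h2 using (hψ.isometricAt _ h2).comp (hf w h1))
  obtain ⟨T, -, hT⟩ := hφ.exists_rigid_eventuallyEq_comp hzφ (f := ψ ∘ h) (by
    filter_upwards [hUz, hhψ] with w h1 h2 using (hψ.isometricAt _ h2).comp (hh w h1))
  obtain ⟨w, hw, hSw, hTw, hwφ⟩ := (hfreq.and_eventually ((eventually_eventually_nhds.2 hS).and
    ((eventually_eventually_nhds.2 hT).and (φ.open_source.mem_nhds hzφ)))).exists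
  have hST : S = T := by
    have ht := φ.map_source hwφ
    have hsymm : Tendsto φ.symm (𝓝 (φ w)) (𝓝 w) := by
      have := φ.continuousAt_symm ht
      rwa [ContinuousAt, φ.left_inv hwφ] at this
    refine aff_eq_of_eventuallyEq (x := φ w) ?_
    filter_upwards [hsymm.eventually hw, hsymm.eventually hSw, hsymm.eventually hTw,
      φ.open_target.mem_nhds ht] with y h1 h2 h3 h4
    simp only [Function.comp_apply, φ.right_inv h4] at h2 h3
    rw [← h2, ← h3, h1]
  change f =ᶠ[𝓝 z] h
  filter_upwards [hS, hT, hfψ, hhψ] with y h1 h2 h3 h4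
  exact ψ.injOn h3 h4 (by rw [← Function.comp_apply (f := ψ) (g := f), h1, hST, ← h2]; rfl)

/-! ### Radial continuation -/

/-- Germs that satisfy a local condition with unique continuation, and that extend to balls of a
locally uniform radius, extend to the whole space. -/
theorem exists_global_extension {P : (E n → E n) → E n → Prop}
    (hcongr : ∀ f h z, P f z → f =ᶠ[𝓝 z] h → P h z)
    (huniq : ∀ U, IsOpen U → IsPreconnected U → ∀ f h, (∀ z ∈ U, P f z) → (∀ z ∈ U, P h z) →
      ∀ x ∈ U, f =ᶠ[𝓝 x] h → EqOn f h U)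
    (c : E n)
    (hext : ∀ M : ℝ, ∃ r > 0, ∀ p ∈ ball c M, ∀ f, (∀ᶠ z in 𝓝 p, P f z) →
      ∃ h, (∀ z ∈ ball p r, P h z) ∧ h =ᶠ[𝓝 p] f)
    {f₀ : E n → E n} (hf₀ : ∀ᶠ z in 𝓝 c, P f₀ z) :
    ∃ f, (∀ z, P f z) ∧ f =ᶠ[𝓝 c] f₀ := by
  have step : ∀ M r : ℝ, 0 < r → (∀ p ∈ ball c M, ∀ f, (∀ᶠ z in 𝓝 p, P f z) →
      ∃ h, (∀ z ∈ ball p r, P h z) ∧ h =ᶠ[𝓝 p] f) →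
      ∀ R, 0 < R → R ≤ M → (∃ f, (∀ z ∈ ball c R, P f z) ∧ f =ᶠ[𝓝 c] f₀) →
      ∃ f, (∀ z ∈ ball c (R + r), P f z) ∧ f =ᶠ[𝓝 c] f₀ := by
    rintro M r hr hM R hR hRM ⟨f, hf, hff₀⟩
    have : ∀ p : E n, ∃ h : E n → E n, p ∈ ball c R →
        (∀ z ∈ ball p r, P h z) ∧ h =ᶠ[𝓝 p] f := fun p => by
      by_cases hp : p ∈ ball c R
      · obtain ⟨h, hh⟩ := hM p (ball_subset_ball hRM hp) f
          (eventually_of_mem (isOpen_ball.mem_nhds hp) hf)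
        exact ⟨h, fun _ => hh⟩
      · exact ⟨f, fun hp' => (hp hp').elim⟩
    choose h hh using this
    have hagree : ∀ p ∈ ball c R, ∀ z ∈ ball p r ∩ ball c R, h p =ᶠ[𝓝 z] f := fun p hp z hz =>
      eventually_of_mem ((isOpen_ball.inter isOpen_ball).mem_nhds hz)
        (huniq _ (isOpen_ball.inter isOpen_ball)
          ((convex_ball p r).inter (convex_ball c R)).isPreconnected _ _
          (fun w hw => (hh p hp).1 w hw.1) (fun w hw => hf w hw.2) p ⟨mem_ball_self hr, hp⟩
          (hh p hp).2)
    -- If the balls around `p` and `q` meet, the midpoint lies in both and, by convexity, in `ball c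
    -- R`. There both extensions agree with `f`, and the convex overlap propagates this.
    have hagree' : ∀ p ∈ ball c R, ∀ q ∈ ball c R, EqOn (h p) (h q) (ball p r ∩ ball q r) := by
      intro p hp q hq z hz
      have hmid : midpoint ℝ p q ∈ ball p r ∩ ball q r := by
        have h1 : dist p q < 2 * r := by
          have := dist_triangle_right p q z
          have h2 := mem_ball'.1 hz.1
          have h3 := mem_ball'.1 hz.2
          linarith
        constructor
        · rw [mem_ball, dist_midpoint_left, Real.norm_eq_abs, abs_of_pos two_pos]
          linarith
        · rw [mem_ball, dist_midpoint_right, Real.norm_eq_abs, abs_of_pos two_pos]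
          linarith
      have hmid' : midpoint ℝ p q ∈ ball c R :=
        (convex_ball c R).midpoint_mem hp hq
      exact huniq _ (isOpen_ball.inter isOpen_ball)
        ((convex_ball p r).inter (convex_ball q r)).isPreconnected _ _
        (fun w hw => (hh p hp).1 w hw.1) (fun w hw => (hh q hq).1 w hw.2) _ hmid
        ((hagree p hp _ ⟨hmid.1, hmid'⟩).trans (hagree q hq _ ⟨hmid.2, hmid'⟩).symm) hz
    have hcover : ∀ z ∈ ball c (R + r), ∃ p ∈ ball c R, z ∈ ball p r := fun z hz => by
      have hz' : z ∈ ball c (r + R) := by rwa [add_comm]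
      rw [← thickening_ball hr hR, mem_thickening_iff] at hz'
      obtain ⟨p, hp, hzp⟩ := hz'
      exact ⟨p, hp, hzp⟩
    have : ∀ z : E n, ∃ p : E n, z ∈ ball c (R + r) → p ∈ ball c R ∧ z ∈ ball p r := fun z => by
      by_cases hz : z ∈ ball c (R + r)
      · obtain ⟨p, hp⟩ := hcover z hz
        exact ⟨p, fun _ => hp⟩
      · exact ⟨0, fun hz' => (hz hz').elim⟩
    choose s hs using this
    let F : E n → E n := fun z => h (s z) z
    have hF : ∀ p ∈ ball c R, ∀ z ∈ ball p r, F =ᶠ[𝓝 z] h p := fun p hp z hz => by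
      filter_upwards [isOpen_ball.mem_nhds hz] with w hw
      have hwc : w ∈ ball c (R + r) := by
        rw [mem_ball] at *
        linarith [dist_triangle w p c]
      exact hagree' _ (hs w hwc).1 p hp ⟨(hs w hwc).2, hw⟩
    refine ⟨F, fun z hz => ?_, ?_⟩
    · obtain ⟨p, hp, hzp⟩ := hcover z hz
      exact hcongr _ _ _ ((hh p hp).1 z hzp) (hF p hp z hzp).symm
    · exact (hF c (mem_ball_self hR) c (mem_ball_self hr)).trans
        ((hh c (mem_ball_self hR)).2.trans hff₀)
  obtain ⟨ε, hε, hball⟩ := Metric.eventually_nhds_iff_ball.1 hf₀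
  have hbig : ∀ M : ℝ, 0 < M → ∃ f, (∀ z ∈ ball c M, P f z) ∧ f =ᶠ[𝓝 c] f₀ := fun M hM => by
    obtain ⟨r, hr, hrM⟩ := hext M
    -- The step length `r` is valid only for centres within `M`, so the radius grows by `r` until it
    -- passes `M`.
    have hind : ∀ k : ℕ, ∃ R, min M (ε + k * r) ≤ R ∧ 0 < R ∧
        ∃ f, (∀ z ∈ ball c R, P f z) ∧ f =ᶠ[𝓝 c] f₀ := fun k => by
      induction k with
      | zero => exact ⟨ε, by simp, hε, f₀, hball, .rfl⟩
      | succ k ih =>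
        obtain ⟨R, hR, hR0, hex⟩ := ih
        rcases le_total R M with hle | hle
        · refine ⟨R + r, ?_, by linarith, step M r hr hrM R hR0 hle hex⟩
          push_cast
          rcases min_le_iff.1 hR with h1 | h1
          · exact (min_le_left _ _).trans (by linarith)
          · exact (min_le_right _ _).trans (by linarith)
        · exact ⟨R, (min_le_left _ _).trans hle, hR0, hex⟩
    obtain ⟨k, hk⟩ := exists_nat_gt (M / r)
    obtain ⟨R, hR, -, f, hf, hff₀⟩ := hind k
    rw [div_lt_iff₀ hr] at hk
    rw [min_eq_left (by linarith)] at hR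
    exact ⟨f, fun z hz => hf z (ball_subset_ball hR hz), hff₀⟩
  choose F hF hF₀ using fun k : ℕ => hbig (k + 1) (by positivity)
  have hmono : ∀ k l, k ≤ l → EqOn (F k) (F l) (ball c (k + 1)) := fun k l hkl =>
    huniq _ isOpen_ball (convex_ball _ _).isPreconnected _ _ (hF k)
      (fun z hz => hF l z (ball_subset_ball (by gcongr) hz)) c
      (mem_ball_self (by positivity)) ((hF₀ k).trans (hF₀ l).symm)
  let G : E n → E n := fun z => F ⌈dist z c⌉₊ z
  have hmem : ∀ z, z ∈ ball c ((⌈dist z c⌉₊ : ℝ) + 1) := fun z => by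
    rw [mem_ball]
    linarith [Nat.le_ceil (dist z c)]
  have hG : ∀ (k : ℕ) (z : E n), z ∈ ball c ((k : ℝ) + 1) → G z = F k z := fun k z hz => by
    rcases le_total k ⌈dist z c⌉₊ with hle | hle
    · exact (hmono _ _ hle hz).symm
    · exact hmono _ _ hle (hmem z)
  refine ⟨G, fun z => ?_, ?_⟩
  · exact hcongr _ _ _ (hF _ z (hmem z))
      (eventually_of_mem (isOpen_ball.mem_nhds (hmem z)) fun w hw => (hG _ w hw).symm)
  · refine EventuallyEq.trans ?_ (hF₀ 0)
    exact eventually_of_mem (isOpen_ball.mem_nhds (mem_ball_self (by positivity)))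
      fun w hw => hG 0 w hw

/-! ### The developing map -/

/-- An affine transformation as a homeomorphism. -/
def affHomeo (γ : Aff n) : E n ≃ₜ E n :=
  Homeomorph.mk γ.toEquiv (contDiff_aff γ).continuous (contDiff_aff γ⁻¹).continuous

theorem affHomeo_apply (γ : Aff n) (x : E n) : affHomeo γ x = γ x := rfl

theorem FlatMetric.isometricAt_of_mem {π : Subgroup (Aff n)} (g : FlatMetric π) {γ : Aff n}
    (hγ : γ ∈ π) (z : E n) : IsometricAt g.form g.form γ z :=
  isometricAt_aff γ (g.invariant γ hγ z)

theorem IsChart.comp_aff {π : Subgroup (Aff n)} {g : FlatMetric π}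
    {φ : OpenPartialHomeomorph (E n) (E n)} (hφ : IsChart g.form φ) {γ : Aff n} (hγ : γ ∈ π) :
    IsChart g.form ((affHomeo γ).transOpenPartialHomeomorph φ) where
  isometricAt z hz := (hφ.isometricAt (γ z) hz).comp (g.isometricAt_of_mem hγ z)
  isometricAt_symm w hw :=
    (g.isometricAt_of_mem (inv_mem hγ) (φ.symm w)).comp (hφ.isometricAt_symm w hw)

/-- A flat metric with a cocompact symmetry group has charts around all points whose images contain
balls of a uniform radius. -/
theorem FlatMetric.exists_uniform_chart {π : Subgroup (Aff n)} (g : FlatMetric π)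
    (hc : ∃ K : Set (E n), IsCompact K ∧ ∀ x, ∃ γ ∈ π, γ x ∈ K) :
    ∃ r > 0, ∀ q, ∃ φ : OpenPartialHomeomorph (E n) (E n), q ∈ φ.source ∧ IsChart g.form φ ∧
      ball (φ q) r ⊆ φ.target := by
  obtain ⟨K, hK, hcov⟩ := hc
  obtain ⟨r, hr, hrK⟩ : ∃ r > 0, ∀ q ∈ K, ∃ φ : OpenPartialHomeomorph (E n) (E n), q ∈ φ.source ∧
      IsChart g.form φ ∧ ball (φ q) r ⊆ φ.target := by
    refine hK.induction_on (p := fun s => ∃ r > 0, ∀ q ∈ s,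
      ∃ φ : OpenPartialHomeomorph (E n) (E n), q ∈ φ.source ∧
        IsChart g.form φ ∧ ball (φ q) r ⊆ φ.target) ⟨1, one_pos, fun q hq => hq.elim⟩ ?_ ?_ ?_
    · rintro s t hst ⟨r, hr, h⟩
      exact ⟨r, hr, fun q hq => h q (hst hq)⟩
    · rintro s t ⟨r, hr, h⟩ ⟨r', hr', h'⟩
      refine ⟨min r r', lt_min hr hr', ?_⟩
      rintro q (hq | hq)
      · obtain ⟨φ, h1, h2, h3⟩ := h q hq
        exact ⟨φ, h1, h2, (ball_subset_ball (min_le_left _ _)).trans h3⟩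
      · obtain ⟨φ, h1, h2, h3⟩ := h' q hq
        exact ⟨φ, h1, h2, (ball_subset_ball (min_le_right _ _)).trans h3⟩
    · intro x _
      obtain ⟨φ, hx, hφ⟩ := g.isFlatForm x
      obtain ⟨ε, hε, hball⟩ := Metric.isOpen_iff.1 φ.open_target _ (φ.map_source hx)
      have hnhds : φ.source ∩ φ ⁻¹' ball (φ x) (ε / 2) ∈ 𝓝 x :=
        inter_mem (φ.open_source.mem_nhds hx)
          ((φ.continuousAt hx).preimage_mem_nhds (ball_mem_nhds (φ x) (half_pos hε)))
      refine ⟨_, mem_nhdsWithin_of_mem_nhds hnhds, ε / 2, half_pos hε, ?_⟩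
      rintro q ⟨hq1, hq2⟩
      refine ⟨φ, hq1, hφ, fun w hw => hball ?_⟩
      rw [mem_preimage, mem_ball] at hq2
      rw [mem_ball] at hw ⊢
      linarith [dist_triangle w (φ q) (φ x)]
  -- Precomposing a chart with `γ` leaves its image unchanged, so the radius found over `K` works
  -- everywhere.
  refine ⟨r, hr, fun q => ?_⟩
  obtain ⟨γ, hγ, hγK⟩ := hcov q
  obtain ⟨φ, h1, h2, h3⟩ := hrK _ hγK
  exact ⟨(affHomeo γ).transOpenPartialHomeomorph φ, h1, h2.comp_aff hγ, h3⟩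

/-- A flat metric on `ℝⁿ` with a cocompact symmetry group is isometric to the Euclidean metric. -/
theorem FlatMetric.exists_developing {π : Subgroup (Aff n)} (g : FlatMetric π)
    (hc : ∃ K : Set (E n), IsCompact K ∧ ∀ x, ∃ γ ∈ π, γ x ∈ K) :
    ∃ D : E n ≃ₜ E n, (∀ z, IsometricAt g.form (euclForm n) D z) ∧
      ∀ w, IsometricAt (euclForm n) g.form D.symm w := by
  have hflat := g.isFlatForm
  have hee := isFlatForm_euclForm (n := n)
  obtain ⟨φ, h0, hφ⟩ := hflat 0
  -- Maps into Euclidean space extend over any source chart, so a Lebesgue number for each closed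
  -- ball is enough.
  obtain ⟨D, hD, hD0⟩ := exists_global_extension (P := IsometricAt g.form (euclForm n))
    (fun f h z hf hfh => hf.congr hfh)
    (fun U hU hUc f h hf hh x hx hfh => eqOn_of_isometricAt hflat hee hU hUc hf hh hx hfh) 0
    (fun M => by
      choose ψ hψ hψc using hflat
      obtain ⟨r, hr, hrM⟩ := lebesgue_number_lemma_of_metric (isCompact_closedBall (0 : E n) M)
        (fun i => (ψ i).open_source) (fun x _ => mem_iUnion.2 ⟨x, hψ x⟩)
      refine ⟨r, hr, fun p hp f hf => ?_⟩
      obtain ⟨i, hi⟩ := hrM p (ball_subset_closedBall hp)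
      obtain ⟨T, hT, heq⟩ := (hψc i).exists_rigid_eventuallyEq_comp (hi (mem_ball_self hr)) hf
      exact ⟨T ∘ ψ i, fun z hz => (isometricAt_rigid hT _).comp ((hψc i).isometricAt z (hi hz)),
        heq.symm⟩)
    (eventually_of_mem (φ.open_source.mem_nhds h0) hφ.isometricAt)
  have ht := φ.map_source h0
  obtain ⟨r, hr, huni⟩ := g.exists_uniform_chart hc
  -- The candidate inverse extends by inverse charts of `g`, whose images must contain balls of a
  -- uniform radius; this is where cocompactness is needed.
  obtain ⟨X, hX, hX0⟩ := exists_global_extension (P := IsometricAt (euclForm n) g.form)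
    (fun f h z hf hfh => hf.congr hfh)
    (fun U hU hUc f h hf hh x hx hfh => eqOn_of_isometricAt hee hflat hU hUc hf hh hx hfh) (φ 0)
    (fun M => by
      refine ⟨r, hr, fun p _ f hf => ?_⟩
      obtain ⟨ψ, hψ, hψc, hball⟩ := huni (f p)
      have hfp := hf.self_of_nhds.continuousAt
      have hsrc : ∀ᶠ z in 𝓝 p, f z ∈ ψ.source := hfp (ψ.open_source.mem_nhds hψ)
      obtain ⟨T, hT, heq⟩ := exists_rigid_eventuallyEq (x := p) (f := ψ ∘ f) (by
        filter_upwards [hf, hsrc] with z h1 h2 using (hψc.isometricAt _ h2).comp h1)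
      have hTp : ψ (f p) = T p := heq.eq_of_nhds
      refine ⟨ψ.symm ∘ T, fun z hz => (hψc.isometricAt_symm _ (hball ?_)).comp
        (isometricAt_rigid hT z), ?_⟩
      · rw [mem_ball, dist_eq_norm] at hz ⊢
        rwa [hTp, aff_apply_sub, hT]
      · filter_upwards [heq, hsrc] with z h1 h2
        rw [Function.comp_apply, ← h1, Function.comp_apply, ψ.left_inv h2])
    (eventually_of_mem (φ.open_target.mem_nhds ht) hφ.isometricAt_symm)
  have hDX : ∀ w, D (X w) = w := fun w => by
    refine eqOn_of_isometricAt hee hee isOpen_univ isPreconnected_univ (f := D ∘ X) (h := id)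
      (fun z _ => (hD _).comp (hX z)) (fun z _ => isometricAt_id _ z) (mem_univ (φ 0)) ?_
      (mem_univ w)
    have hX00 : X (φ 0) = 0 := by rw [hX0.eq_of_nhds, φ.left_inv h0]
    have hlim : Tendsto X (𝓝 (φ 0)) (𝓝 0) := by
      have := (hX (φ 0)).continuousAt
      rwa [ContinuousAt, hX00] at this
    filter_upwards [hX0, hlim.eventually hD0, φ.open_target.mem_nhds ht] with z h1 h2 h3
    rw [Function.comp_apply, h2, h1, φ.right_inv h3]; rfl
  have hXD : ∀ z, X (D z) = z := fun z => by
    refine eqOn_of_isometricAt hflat hflat isOpen_univ isPreconnected_univ (f := X ∘ D) (h := id)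
      (fun z _ => (hX _).comp (hD z)) (fun z _ => isometricAt_id _ z) (mem_univ 0) ?_ (mem_univ z)
    have hlim : Tendsto D (𝓝 0) (𝓝 (φ 0)) := by
      have := (hD 0).continuousAt
      rwa [ContinuousAt, hD0.eq_of_nhds] at this
    filter_upwards [hD0, hlim.eventually hX0, φ.open_source.mem_nhds h0] with z h1 h2 h3
    rw [Function.comp_apply, h2, h1, φ.left_inv h3]; rfl
  exact ⟨{ toFun := D, invFun := X, left_inv := hXD, right_inv := hDX,
           continuous_toFun := continuous_iff_continuousAt.2 fun z => (hD z).continuousAt,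
           continuous_invFun := continuous_iff_continuousAt.2 fun z => (hX z).continuousAt },
    hD, hX⟩

/-! ### Isometries of orbifolds and isometries of `ℝⁿ` -/

theorem proj_eq_iff {π : Subgroup (Aff n)} {x y : E n} :
    proj π x = proj π y ↔ ∃ γ ∈ π, γ x = y :=
  ⟨fun h => Quotient.exact h, fun h => Quotient.sound h⟩

/-- An isometry of `ℝⁿ` which conjugates `π` to `π'` induces an isometry of orbifolds. -/
theorem isometric_of_homeomorph {π π' : Subgroup (Aff n)} {g : FlatMetric π} {g' : FlatMetric π'}
    (G : E n ≃ₜ E n) (hG : ∀ z, IsometricAt g.form g'.form G z)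
    (hG' : ∀ w, IsometricAt g'.form g.form G.symm w)
    (hc : ∀ γ ∈ π, ∃ γ' ∈ π', ∀ x, G (γ x) = γ' (G x))
    (hc' : ∀ γ' ∈ π', ∃ γ ∈ π, ∀ x, G (γ x) = γ' (G x)) : Isometric g g' := by
  have hrel : ∀ x y, (orbitSetoid π).r x y ↔ (orbitSetoid π').r (G x) (G y) := by
    intro x y
    constructor
    · rintro ⟨γ, hγ, rfl⟩
      obtain ⟨γ', hγ', h⟩ := hc γ hγ
      exact ⟨γ', hγ', (h x).symm⟩
    · rintro ⟨γ', hγ', hxy⟩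
      obtain ⟨γ, hγ, h⟩ := hc' γ' hγ'
      exact ⟨γ, hγ, G.injective (by rw [h, hxy])⟩
  let e : Space π ≃ Space π' := Quotient.congr G.toEquiv hrel
  have he : ∀ x, e (proj π x) = proj π' (G x) := fun x => rfl
  let f : Space π ≃ₜ Space π' :=
    { toEquiv := e
      continuous_toFun := continuous_quot_lift _ (continuous_quot_mk.comp G.continuous)
      continuous_invFun := continuous_quot_lift _ (continuous_quot_mk.comp G.symm.continuous) }
  refine ⟨f, fun x y hxy => ?_⟩
  -- The prescribed point `y` need not be `G x`, only in its orbit; the local lift is corrected by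
  -- `γ'`.
  obtain ⟨γ', hγ', hy⟩ := proj_eq_iff.1 ((he x).symm.trans hxy)
  have h1 : ∀ z, IsometricAt g.form g'.form (γ' ∘ G) z := fun z =>
    (g'.isometricAt_of_mem hγ' (G z)).comp (hG z)
  have h2 : ∀ w, IsometricAt g'.form g.form (G.symm ∘ (γ'⁻¹ : Aff n)) w := fun w =>
    (hG' _).comp (g'.isometricAt_of_mem (inv_mem hγ') w)
  refine ⟨(G.trans (affHomeo γ')).toOpenPartialHomeomorph, trivial, hy,
    fun z _ => (h1 z).1.contDiffWithinAt, fun w _ => (h2 w).1.contDiffWithinAt,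
    fun z _ => ⟨?_, (h1 z).2⟩⟩
  change proj π' (γ' (G z)) = e (proj π z)
  rw [he, eq_comm]
  exact proj_eq_iff.2 ⟨γ', hγ', rfl⟩

/-- If two affine transformations agree modulo a countable group at every point of a nonempty open
set then they agree modulo the group. -/
theorem exists_mul_eq_of_forall_exists {π : Subgroup (Aff n)} (hπ : (π : Set (Aff n)).Countable)
    {S T : Aff n} {V : Set (E n)} (hV : IsOpen V) (hne : V.Nonempty)
    (h : ∀ w ∈ V, ∃ γ ∈ π, γ (S w) = T w) : ∃ γ ∈ π, γ * S = T := by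
  by_contra! hcon
  -- Baire: if no `γ * S` equals `T`, each coincidence set is closed with empty interior, and
  -- countably many of these cannot cover `V`.
  have hdense : Dense (⋂ γ ∈ (π : Set (Aff n)), {w : E n | γ (S w) = T w}ᶜ) := by
    have hclosed : ∀ γ : Aff n, IsClosed {w : E n | γ (S w) = T w} := fun γ =>
      isClosed_eq ((contDiff_aff γ).continuous.comp (contDiff_aff S).continuous)
        (contDiff_aff T).continuous
    refine dense_biInter_of_isOpen (fun γ _ => (hclosed γ).isOpen_compl) hπ fun γ hγ => ?_
    rw [← interior_eq_empty_iff_dense_compl]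
    by_contra hint
    obtain ⟨x, hx⟩ := nonempty_iff_ne_empty.2 hint
    exact hcon γ hγ (aff_eq_of_eventuallyEq (x := x) (mem_interior_iff_mem_nhds.1 hx))
  obtain ⟨w, hwV, hw⟩ := hdense.exists_mem_open hV hne
  obtain ⟨γ, hγ, heq⟩ := h w hw
  exact mem_iInter₂.1 hwV γ hγ heq

/-- Isometries between Euclidean orbifolds lift to rigid motions. -/
theorem exists_rigid_conj {π π' : Subgroup (Aff n)} (hπ : IsRigid π) (hπ' : IsRigid π')
    (hcount : (π : Set (Aff n)).Countable) (hcount' : (π' : Set (Aff n)).Countable)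
    (h : Isometric (euclideanMetric π hπ) (euclideanMetric π' hπ')) :
    ∃ T : Aff n, linPart n T ∈ orthGroup n ∧ conjGroup T π = π' := by
  obtain ⟨f, hf⟩ := h
  have hlocal : ∀ x, ∃ T : Aff n, linPart n T ∈ orthGroup n ∧
      ∀ᶠ z in 𝓝 x, proj π' (T z) = f (proj π z) := fun x => by
    obtain ⟨y, hy⟩ : ∃ y, proj π' y = f (proj π x) := Quotient.exists_rep _
    obtain ⟨F, hx, -, hF, -, hlift⟩ := hf x y hy.symm
    obtain ⟨T, hT, heq⟩ := exists_rigid_eventuallyEq (x := x) (f := F)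
      (eventually_of_mem (F.open_source.mem_nhds hx) fun z hz =>
        ⟨hF.contDiffAt (F.open_source.mem_nhds hz), (hlift z hz).2⟩)
    refine ⟨T, hT, ?_⟩
    filter_upwards [heq, F.open_source.mem_nhds hx] with z h1 h2
    rw [← h1, (hlift z h2).1]
  obtain ⟨T, hT, hT0⟩ := hlocal 0
  have hglobal : ∀ z, proj π' (T z) = f (proj π z) := by
    suffices univ ⊆ {z | ∀ᶠ w in 𝓝 z, proj π' (T w) = f (proj π w)} from
      fun z => (this (mem_univ z)).self_of_nhds
    have hopen : IsOpen {z | ∀ᶠ w in 𝓝 z, proj π' (T w) = f (proj π w)} :=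
      isOpen_iff_eventually.2 fun z hz => eventually_eventually_nhds.2 hz
    refine isPreconnected_univ.subset_of_closure_inter_subset hopen ⟨0, trivial, hT0⟩ ?_
    -- Near a limit point `z`, a local lift `S` and the motion `T` lift `f` on a common open set.
    -- Hence `T = γ * S` with `γ` in `π'`, and `T` lifts `f` near `z` as well.
    rintro z ⟨hz, -⟩
    obtain ⟨S, -, hSz⟩ := hlocal z
    obtain ⟨r, hr, hball⟩ := Metric.eventually_nhds_iff_ball.1 hSz
    obtain ⟨w, hw, hwz⟩ := Metric.mem_closure_iff.1 hz r hr
    obtain ⟨γ, hγ, rfl⟩ := exists_mul_eq_of_forall_exists hcount' (S := S) (T := T)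
      (isOpen_ball.inter hopen) ⟨w, mem_ball'.2 hwz, hw⟩ fun y hy =>
        proj_eq_iff.1 ((hball y hy.1).trans hy.2.self_of_nhds.symm)
    change ∀ᶠ y in 𝓝 z, proj π' ((γ * S) y) = f (proj π y)
    filter_upwards [hSz] with y hy
    rw [← hy, eq_comm]
    exact proj_eq_iff.2 ⟨γ, hγ, rfl⟩
  refine ⟨T, hT, ?_⟩
  ext δ
  constructor
  · rintro ⟨γ, hγ, rfl⟩
    -- `T` and `T * γ` lift the same map `f`, so they differ by an element of `π'`.
    obtain ⟨γ', hγ', heq⟩ := exists_mul_eq_of_forall_exists hcount' (S := T) (T := T * γ)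
      isOpen_univ univ_nonempty fun w _ => proj_eq_iff.1 (by
        rw [aff_mul_apply, hglobal, hglobal]
        exact congrArg f (proj_eq_iff.2 ⟨γ, hγ, rfl⟩))
    change T * γ * T⁻¹ ∈ π'
    rwa [← heq, mul_inv_cancel_right]
  · intro hδ
    obtain ⟨γ, hγ, heq⟩ := exists_mul_eq_of_forall_exists hcount (S := T⁻¹) (T := T⁻¹ * δ)
      isOpen_univ univ_nonempty fun w _ => proj_eq_iff.1 (f.injective (by
        rw [aff_mul_apply, ← hglobal, ← hglobal, aff_apply_inv_self, aff_apply_inv_self]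
        exact proj_eq_iff.2 ⟨δ, hδ, rfl⟩))
    refine ⟨γ, hγ, ?_⟩
    change T * γ * T⁻¹ = δ
    rw [mul_assoc, heq, mul_inv_cancel_left]

/-! ### Moduli of flat metrics -/

theorem inner_map_conj {π : Subgroup (Aff n)} {A : GLin n} (hA : A ∈ cone π) {γ : Aff n}
    (hγ : γ ∈ π) (u v : E n) :
    inner ℝ (A (linPart n γ u)) (A (linPart n γ v)) = inner ℝ (A u) (A v) := by
  have hO := hA _ (Subgroup.mem_map_of_mem (linPart n) hγ)
  have h1 : ∀ w, (A * linPart n γ * A⁻¹) (A w) = A (linPart n γ w) := fun w =>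
    congrArg (fun z => A (linPart n γ z)) (A.symm_apply_apply w)
  rw [← h1 u, ← h1 v]
  exact (orthIsometry hO).inner_map_map _ _

/-- The constant metric `⟨A u, A v⟩` on `ℝⁿ/π`. -/
def constMetric {π : Subgroup (Aff n)} (A : cone π) : FlatMetric π where
  form _ := (innerSL ℝ).bilinearComp (toEnd A.1) (toEnd A.1)
  smooth := contDiff_const
  symm _ u v := real_inner_comm (A.1 v) (A.1 u)
  pos _ u hu := real_inner_self_pos.2 ((LinearEquiv.map_ne_zero_iff A.1).2 hu)
  invariant γ hγ _ u v := inner_map_conj A.2 hγ u v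
  flat x := by
    refine ⟨(affHomeo (mkAff A.1 0)).toOpenPartialHomeomorph, trivial,
      (contDiff_aff (mkAff A.1 0)).contDiffOn, (contDiff_aff (mkAff A.1 0)⁻¹).contDiffOn,
      fun z _ u v => ?_⟩
    change inner ℝ (fderiv ℝ (mkAff A.1 0) z u) (fderiv ℝ (mkAff A.1 0) z v) = _
    rw [fderiv_aff, linPart_mkAff]
    rfl

theorem constMetric_form {π : Subgroup (Aff n)} (A : cone π) (x u v : E n) :
    (constMetric A).form x u v = inner ℝ (A.1 u) (A.1 v) := rfl

/-- An affine transformation which conjugates `π` to `π'` and pulls `g'` back to `g` induces an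
isometry of orbifolds. -/
theorem isometric_of_aff {π π' : Subgroup (Aff n)} {g : FlatMetric π} {g' : FlatMetric π'}
    (a : Aff n) (hπ : conjGroup a π = π')
    (h : ∀ z u v, g'.form (a z) (linPart n a u) (linPart n a v) = g.form z u v) :
    Isometric g g' := by
  subst hπ
  refine isometric_of_homeomorph (affHomeo a) (fun z => isometricAt_aff a (h z))
    (fun w => isometricAt_aff a⁻¹ fun u v => ?_) (fun γ hγ => ⟨a * γ * a⁻¹, ⟨γ, hγ, rfl⟩,
      fun x => ?_⟩) ?_
  · rw [← h, aff_apply_inv_self, linPart_apply_inv_self, linPart_apply_inv_self]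
  · rw [affHomeo_apply, affHomeo_apply, aff_mul_apply, aff_mul_apply, aff_inv_apply_self]
  · rintro _ ⟨γ, hγ, rfl⟩
    refine ⟨γ, hγ, fun x => ?_⟩
    change a (γ x) = (a * γ * a⁻¹) (a x)
    rw [aff_mul_apply, aff_mul_apply, aff_inv_apply_self]

/-- The constant metric is the pullback of the Euclidean one under `a`; the translation part of `a`
does not affect it. -/
theorem isometric_constMetric_euclideanMetric {π : Subgroup (Aff n)} (a : Aff n)
    (ha : linPart n a ∈ cone π) :
    Isometric (constMetric ⟨linPart n a, ha⟩)
      (euclideanMetric (conjGroup a π) (isRigid_conjGroup ha)) :=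
  isometric_of_aff a rfl fun _ _ _ => rfl

theorem conjGroup_mul (a b : Aff n) (π : Subgroup (Aff n)) :
    conjGroup (a * b) π = conjGroup a (conjGroup b π) := by
  rw [conjGroup, conjGroup, conjGroup, Subgroup.map_map, map_mul]
  rfl

theorem mem_conjGroup {a γ : Aff n} {π : Subgroup (Aff n)} :
    γ ∈ conjGroup a π ↔ a⁻¹ * γ * a ∈ π := by
  constructor
  · rintro ⟨δ, hδ, rfl⟩
    change a⁻¹ * (a * δ * a⁻¹) * a ∈ π
    rwa [mul_assoc, inv_mul_cancel_right, inv_mul_cancel_left]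
  · intro h
    refine ⟨_, h, ?_⟩
    change a * (a⁻¹ * γ * a) * a⁻¹ = γ
    group

theorem conjGroup_eq_self_iff {c : Aff n} {π : Subgroup (Aff n)} :
    conjGroup c π = π ↔ c ∈ Subgroup.normalizer (π : Set (Aff n)) := by
  rw [← inv_mem_iff, Subgroup.mem_set_normalizer_iff, SetLike.ext_iff]
  refine forall_congr' fun γ => ?_
  rw [mem_conjGroup, inv_inv]
  exact iff_comm

theorem teichmullerQuotient_mk_eq_iff {π : Subgroup (Aff n)} {A A' : cone π} :
    TeichmullerQuotient.mk (Teichmuller.mk A) = TeichmullerQuotient.mk (Teichmuller.mk A') ↔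
      ∃ B ∈ orthGroup n, ∃ C ∈ linNormalizer π, B * A.1 = A'.1 * C := by
  constructor
  · intro h
    obtain ⟨C, hC⟩ := MulAction.orbitRel_apply.1 (Quotient.exact h)
    obtain ⟨B, hB⟩ := MulAction.orbitRel_apply.1
      (Quotient.exact (hC : Teichmuller.mk (C • A') = Teichmuller.mk A))
    exact ⟨B.1, B.2, C.unop.1, C.unop.2, congrArg Subtype.val hB⟩
  · rintro ⟨B, hB, C, hC, h⟩
    refine Quotient.sound (MulAction.orbitRel_apply.2 ⟨MulOpposite.op ⟨C, hC⟩, ?_⟩)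
    change Teichmuller.mk _ = Teichmuller.mk A
    refine Quotient.sound (MulAction.orbitRel_apply.2 ⟨⟨B, hB⟩, ?_⟩)
    exact Subtype.ext h

theorem IsProperCocompact.countable_conjGroup {π : Subgroup (Aff n)} (h : IsProperCocompact π)
    (a : Aff n) : (conjGroup a π : Set (Aff n)).Countable :=
  h.countable.image _

/-- Passing to Euclidean orbifolds, an isometry lifts to a rigid `T`, and `a'⁻¹ * T * a` normalizes
`π`. Conversely, an element `c` of the normalizer with linear part `C` descends to an isometry,
because `A' C = B A` with `B` orthogonal. -/
theorem IsProperCocompact.isometric_constMetric_iff {π : Subgroup (Aff n)}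
    (h : IsProperCocompact π) {A A' : cone π} :
    Isometric (constMetric A) (constMetric A') ↔
      ∃ B ∈ orthGroup n, ∃ C ∈ linNormalizer π, B * A.1 = A'.1 * C := by
  constructor
  · intro hiso
    have hlift : ∀ A : cone π, ∃ a : Aff n, linPart n a = A.1 := fun A =>
      ⟨mkAff A.1 0, linPart_mkAff _ _⟩
    obtain ⟨A, hA⟩ := A
    obtain ⟨A', hA'⟩ := A'
    obtain ⟨a, rfl⟩ := hlift ⟨A, hA⟩
    obtain ⟨a', rfl⟩ := hlift ⟨A', hA'⟩
    obtain ⟨T, hT, hconj⟩ := exists_rigid_conj (isRigid_conjGroup hA) (isRigid_conjGroup hA')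
      (h.countable_conjGroup a) (h.countable_conjGroup a')
      (((isometric_constMetric_euclideanMetric a hA).symm.trans hiso).trans
        (isometric_constMetric_euclideanMetric a' hA'))
    refine ⟨linPart n T, hT, linPart n (a'⁻¹ * T * a), ⟨_, ?_, rfl⟩, ?_⟩
    · rw [SetLike.mem_coe, ← conjGroup_eq_self_iff, mul_assoc, conjGroup_mul, conjGroup_mul, hconj,
        ← conjGroup_mul, inv_mul_cancel]
      ext γ
      rw [mem_conjGroup, inv_one, one_mul, mul_one]
    · rw [← map_mul, ← map_mul]
      congr 1
      group
  · rintro ⟨B, hB, _, ⟨c, hc, rfl⟩, heq⟩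
    refine isometric_of_aff c (conjGroup_eq_self_iff.2 hc) fun z u v => ?_
    have h1 : ∀ w, A'.1 (linPart n c w) = B (A.1 w) := fun w =>
      (DFunLike.congr_fun heq w).symm
    rw [constMetric_form, constMetric_form, h1, h1]
    exact (orthIsometry hB).inner_map_map _ _

/-- Every flat metric is isometric to a constant one. -/
theorem IsProperCocompact.exists_isometric_constMetric {π : Subgroup (Aff n)}
    (h : IsProperCocompact π) (g : FlatMetric π) : ∃ A : cone π, Isometric g (constMetric A) := by
  obtain ⟨D, hD, hD'⟩ := g.exists_developing h.cocompact
  -- Conjugated by `D`, each `γ` becomes a global isometry of Euclidean space, hence a rigid motion.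
  have hex : ∀ γ : π, ∃ T : Aff n, linPart n T ∈ orthGroup n ∧
      ∀ x, D ((γ : Aff n) (D.symm x)) = T x := fun γ => by
    obtain ⟨T, hT, heq⟩ := exists_rigid_eqOn isOpen_univ isPreconnected_univ univ_nonempty
      (f := D ∘ ((γ : Aff n) ∘ D.symm)) fun z _ =>
        (hD _).comp ((g.isometricAt_of_mem γ.2 _).comp (hD' z))
    exact ⟨T, hT, fun x => heq (mem_univ x)⟩
  choose T hT hDT using hex
  let ρ : π →* Aff n := MonoidHom.mk' T fun γ δ => by
    ext1 x
    rw [aff_mul_apply, ← hDT, ← hDT, ← hDT, D.symm_apply_apply]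
    rfl
  have hρ : ∀ (γ : π) x, D ((γ : Aff n) x) = ρ γ (D x) := fun γ x => by
    have := hDT γ (D x)
    rwa [D.symm_apply_apply] at this
  have hcr : IsProperCocompact ρ.range := by
    refine ⟨?_, fun R => ?_, ?_⟩
    · rintro _ ⟨γ, rfl⟩
      exact hT γ
    -- If `ρ γ` moves `0` by at most `R`, then `γ` maps `D.symm 0` into the compact preimage of the
    -- `R`-ball. This bounds `γ 0`, and properness of `π` applies.
    · obtain ⟨R', hR'⟩ := ((isCompact_closedBall (0 : E n) R).image
        D.symm.continuous).isBounded.exists_norm_le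
      have hfin : {γ : π | ‖(γ : Aff n) 0‖ ≤ R' + ‖D.symm 0‖}.Finite := by
        refine Set.Finite.of_finite_image (f := Subtype.val)
          ((h.proper (R' + ‖D.symm 0‖)).subset ?_) Subtype.val_injective.injOn
        rintro _ ⟨γ, hγ, rfl⟩
        exact ⟨γ.2, hγ⟩
      refine (hfin.image ρ).subset ?_
      rintro _ ⟨⟨γ, rfl⟩, hγ⟩
      refine ⟨γ, ?_, rfl⟩
      have h1 : ‖(γ : Aff n) (D.symm 0)‖ ≤ R' := by
        refine hR' _ ⟨ρ γ 0, by simpa using hγ, ?_⟩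
        rw [← D.apply_symm_apply (0 : E n), ← hρ, D.symm_apply_apply, D.symm_apply_apply]
      have h2 : (γ : Aff n) 0 = (γ : Aff n) (D.symm 0) - linPart n γ (D.symm 0) := by
        rw [aff_apply (γ : Aff n) (D.symm 0)]; abel
      change ‖(γ : Aff n) 0‖ ≤ _
      rw [h2]
      refine (norm_sub_le _ _).trans ?_
      rw [h.rigid γ γ.2]
      linarith
    · obtain ⟨K, hK, hcov⟩ := h.cocompact
      refine ⟨D '' K, hK.image D.continuous, fun x => ?_⟩
      obtain ⟨γ, hγ, hγK⟩ := hcov (D.symm x)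
      exact ⟨ρ ⟨γ, hγ⟩, ⟨_, rfl⟩, _, hγK, hDT ⟨γ, hγ⟩ x⟩
  obtain ⟨a, ha⟩ := h.exists_affine_conj ρ hcr
  have hcone : linPart n a ∈ cone π := by
    rintro _ ⟨γ, hγ, rfl⟩
    rw [← map_inv, ← map_mul, ← map_mul, ← ha ⟨γ, hγ⟩]
    exact hT _
  refine ⟨⟨linPart n a, hcone⟩,
    Isometric.trans ?_ (isometric_constMetric_euclideanMetric a hcone).symm⟩
  refine isometric_of_homeomorph D hD hD'
    (fun γ hγ => ⟨a * γ * a⁻¹, ⟨γ, hγ, rfl⟩, fun x => ?_⟩) ?_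
  · rw [← ha ⟨γ, hγ⟩, ← hρ]
  · rintro _ ⟨γ, hγ, rfl⟩
    refine ⟨γ, hγ, fun x => ?_⟩
    change _ = (a * γ * a⁻¹) (D x)
    rw [← ha ⟨γ, hγ⟩, ← hρ]

theorem moduli_mk_eq_iff {π : Subgroup (Aff n)} {g g' : FlatMetric π} :
    Moduli.mk g = Moduli.mk g' ↔ Isometric g g' :=
  ⟨fun h => Quotient.exact h, fun h => Quotient.sound h⟩

theorem teichmullerQuotient_mk_surjective {π : Subgroup (Aff n)} :
    Function.Surjective fun A : cone π => TeichmullerQuotient.mk (Teichmuller.mk A) := by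
  rintro ⟨⟨A⟩⟩
  exact ⟨A, rfl⟩

/-- The bijection from `T_flat/N_π` to the moduli space of flat metrics takes the class of `A` to the
class of the constant metric `⟨A u, A v⟩`. -/
theorem IsProperCocompact.exists_moduliEquiv {π : Subgroup (Aff n)} (h : IsProperCocompact π) :
    ∃ Φ : TeichmullerQuotient π ≃ Moduli π, ∀ A : cone π,
      Φ (TeichmullerQuotient.mk (Teichmuller.mk A)) = Moduli.mk (constMetric A) := by
  choose s hs using teichmullerQuotient_mk_surjective (π := π)
  have hiff : ∀ A A' : cone π, Moduli.mk (constMetric A) = Moduli.mk (constMetric A') ↔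
      TeichmullerQuotient.mk (Teichmuller.mk A) = TeichmullerQuotient.mk (Teichmuller.mk A') :=
    fun A A' => by
      rw [moduli_mk_eq_iff, h.isometric_constMetric_iff, teichmullerQuotient_mk_eq_iff]
  refine ⟨Equiv.ofBijective (fun q => Moduli.mk (constMetric (s q))) ⟨fun q q' hqq => ?_, ?_⟩,
    fun A => (hiff _ _).2 (hs _)⟩
  · rw [← hs q, ← hs q']
    exact (hiff _ _).1 hqq
  · rintro ⟨g⟩
    obtain ⟨A, hA⟩ := h.exists_isometric_constMetric g
    exact ⟨_, ((hiff _ A).2 (hs _)).trans (moduli_mk_eq_iff.2 hA.symm)⟩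

end FlatOrbifold

end

theorem mainTheorem7 {n : ℕ} (π : Subgroup (FlatOrbifold.Aff n))
    (hπ : FlatOrbifold.IsCrystallographic π) :
    DiscreteTopology (FlatOrbifold.toEnd '' (FlatOrbifold.linNormalizer π :
      Set (FlatOrbifold.GLin n))) ∧
    ∃ Φ : FlatOrbifold.TeichmullerQuotient π ≃ FlatOrbifold.Moduli π,
      ∀ (a : FlatOrbifold.Aff n) (ha : FlatOrbifold.linPart n a ∈ FlatOrbifold.cone π)
        (g : FlatOrbifold.FlatMetric π),
        Φ (FlatOrbifold.TeichmullerQuotient.mk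
            (FlatOrbifold.Teichmuller.mk ⟨FlatOrbifold.linPart n a, ha⟩)) =
          FlatOrbifold.Moduli.mk g ↔
        FlatOrbifold.Isometric g
          (FlatOrbifold.euclideanMetric (FlatOrbifold.conjGroup a π)
            (FlatOrbifold.isRigid_conjGroup ha)) := by
  have h := hπ.isProperCocompact
  refine ⟨h.discreteTopology_linNormalizer, ?_⟩
  obtain ⟨Φ, hΦ⟩ := h.exists_moduliEquiv
  refine ⟨Φ, fun a ha g => ?_⟩
  rw [hΦ, FlatOrbifold.moduli_mk_eq_iff]
  have hiso := FlatOrbifold.isometric_constMetric_euclideanMetric a ha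
  exact ⟨fun h1 => h1.symm.trans hiso, fun h1 => hiso.trans h1.symm⟩
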